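/- Let $d\ge 1$ and $e\ge 1$ be integers and let $v_0,\dots,v_{d-1}$ be integers with $0\le v_0\le\dots\le v_{d-1}<e$. **Multipartitions.** A $d$-partition of rank $n$ is a tuple $\underline\lambda=(\lambda^{(0)},\dots,\lambda^{(d-1)})$ of partitions with $\sum_c|\lambda^{(c)}|=n$; its nodes are the triples $(a,b,c)$ with $0\le c\le d-1$, $a\ge 1$ and $1\le b\le\lambda^{(c)}_a$. The node $\gamma=(a,b,c)$ has residue $b-a+v_c \bmod e\in\mathbb Z/e\mathbb Z$, and is called an $i$-node if its residue is $i$. Addable and removable nodes are defined as usual. The node $(a,b,c)$ is *above* $(a',b',c')$ (and the latter *below* the former) if $b-a+v_c<b'-a'+v_{c'}$, or if $b-a+v_c=b'-a'+v_{c'}$ and $c>c'$. **Fock space.** Let $\mathcal F$ be the $\mathbb C(q)$-vector space with basis all $d$-partitions, with the (JMMO) operators $$f_i\,\underline\lambda=\sum_{\underline\mu} q^{\overline N_i^b(\underline\lambda,\underline\mu)}\,\underline\mu \qquad (i\in\mathbb Z/e\mathbb Z),$$ the sum being over all $\underline\mu$ obtained from $\underline\lambda$ by adding an $i$-node $\gamma$,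 where $\overline N_i^b(\underline\lambda,\underline\mu)$ is the number of addable $i$-nodes of $\underline\lambda$ below $\gamma$ minus the number of removable $i$-nodes of $\underline\mu$ below $\gamma$. Put $[j]_q=\frac{q^j-q^{-j}}{q-q^{-1}}$, $[a]_q!=[1]_q\cdots[a]_q$ and $f_i^{(a)}=f_i^a/[a]_q!$. **FLOTW $d$-partitions.** $\underline\lambda$ is FLOTW if (1) $\lambda^{(j)}_i\ge\lambda^{(j+1)}_{i+v_{j+1}-v_j}$ for $0\le j\le d-2$, $i\ge 1$, and $\lambda^{(d-1)}_i\ge\lambda^{(0)}_{i+e+v_0-v_{d-1}}$ for $i\ge1$; (2) for every $k>0$, some element of $\mathbb Z/e\mathbb Z$ is not the residue of the right end of any row of length $k$ of $\underline\lambda$. **$a$-sequences.** The empty $d$-partition $\underline\emptyset$ has the empty $a$-sequence. For $\underline\lambda\ne\underline\emptyset$ with maximal part length $l_{\max}$, choose a residue $k$ such that some removable $k$-node lies on a part of length $l_{\max}$ and no part of length $l_{\max}$ has a $(k-1)$-node at its right end. Let $\underline\lambda'$ be obtained by removing from $\underline\lambda$ all removable $k$-nodes lying on parts strictly longer than every part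 with a $(k-1)$-node at its right end, and let $s$ be their number. Any $a$-sequence of $\underline\lambda'$ followed by $k$ repeated $s$ times is an $a$-sequence of $\underline\lambda$. **$a$-value.** For $\underline\lambda$ of rank $n$ put $m^{(j)}=v_j-\frac{je}{d}+e$, $B'^{(j)}_p=\lambda^{(j)}_p-p+n+m^{(j)}$ for $1\le p\le n$ (with $\lambda^{(j)}_p=0$ beyond the last part), $B'^{(j)}=\{B'^{(j)}_1,\dots,B'^{(j)}_n\}$, and $$a_1(\underline\lambda)=\sum_{\substack{0\le i\le j<d\\(x,y)\in B'^{(i)}\times B'^{(j)}\\ x>y\text{ if }i=j}}\min\{x,y\}\;-\sum_{\substack{0\le i,j<d\\ x\in B'^{(i)}\\ 1\le k\le x,\ k\in\mathbb Z}}\min\{k,m^{(j)}\},\qquad a(\underline\lambda)=a_1(\underline\lambda)+f(n),$$ where $f:\mathbb N\to\mathbb Q$ is any function. **Statement.** Let $\underline\lambda$ be a FLOTW $d$-partition of rank $n$. Then $\underline\lambda$ has an $a$-sequence. Moreover, for every $a$-sequence of $\underline\lambda$, written as $$\underbrace{i_1,\dots,i_1}_{a_1},\underbrace{i_2,\dots,i_2}_{a_2},\dots,\underbrace{i_s,\dots,i_s}_{a_s}$$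 with all $a_j\ge1$ and $i_j\ne i_{j+1}$ for $1\le j<s$, there are $c_{\underline\lambda,\underline\mu}(q)\in\mathbb Z[q,q^{-1}]$ such that $$f^{(a_s)}_{i_s}f^{(a_{s-1})}_{i_{s-1}}\cdots f^{(a_1)}_{i_1}\,\underline\emptyset=\underline\lambda+\sum_{a(\underline\mu)>a(\underline\lambda)}c_{\underline\lambda,\underline\mu}(q)\,\underline\mu,$$ the sum being over $d$-partitions $\underline\mu$ of rank $n$ with $a(\underline\mu)>a(\underline\lambda)$. -/

import Mathlib

open scoped LaurentPolynomial

namespace JMMO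

/-! Multipartitions, their diagrams and their nodes -/

/-- A `d`-partition: a `d`-tuple of partitions, each given by its Young diagram; the length of the
row `a` (counted from `0`) of the component `c` is `(l c).rowLen a`. -/
abbrev Multipartition (d : ℕ) : Type := Fin d → YoungDiagram

/-- Nodes `(a, b, c)`: row `a`, column `b`, component `c`.  Rows and columns are counted from `0`,
which does not change the differences `b - a`. -/
abbrev Node (d : ℕ) : Type := ℕ × ℕ × Fin d

variable {d : ℕ}

/-- The set of nodes of a `d`-partition. -/
def diagram (l : Multipartition d) : Finset (Node d) :=
  Finset.univ.biUnion fun c : Fin d => (l c).cells.image fun x => (x.1, x.2, c)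

theorem mem_diagram {l : Multipartition d} {g : Node d} :
    g ∈ diagram l ↔ (g.1, g.2.1) ∈ l g.2.2 := by
  obtain ⟨a, b, c⟩ := g
  simp only [diagram, Finset.mem_biUnion, Finset.mem_univ, true_and, Finset.mem_image,
    YoungDiagram.mem_cells, Prod.mk.injEq, Prod.exists]
  constructor
  · rintro ⟨c', x, y, h, rfl, rfl, rfl⟩
    exact h
  · intro h
    exact ⟨c, a, b, h, rfl, rfl, rfl⟩

/-- The rank of a `d`-partition. -/
def rank (l : Multipartition d) : ℕ := ∑ c, (l c).card

/-- The empty `d`-partition. -/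
def emptyMP (d : ℕ) : Multipartition d := fun _ => ⊥

/-- The content of a node, shifted by `v`: the integer `b - a + v_c`. -/
def content (v : Fin d → ℕ) (g : Node d) : ℤ := (g.2.1 : ℤ) - (g.1 : ℤ) + (v g.2.2 : ℤ)

/-- The residue of a node, in `ℤ/eℤ`. -/
def residue (e : ℕ) (v : Fin d → ℕ) (g : Node d) : ZMod e := (content v g : ZMod e)

/-- `g` is an addable node of `l`: adding it gives the diagram of a `d`-partition. -/
def IsAddable (l : Multipartition d) (g : Node d) : Prop :=
  g ∉ diagram l ∧ ∃ m : Multipartition d, diagram m = insert g (diagram l)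

/-- `g` is a removable node of `l`: removing it leaves the diagram of a `d`-partition. -/
def IsRemovable (l : Multipartition d) (g : Node d) : Prop :=
  g ∈ diagram l ∧ ∃ m : Multipartition d, diagram m = (diagram l).erase g

open Classical in
/-- The finite set of addable nodes (the bounds only serve to make finiteness visible,
see `mem_addableNodes`). -/
noncomputable def addableNodes (l : Multipartition d) : Finset (Node d) :=
  (Finset.range (rank l + 1) ×ˢ Finset.range (rank l + 1) ×ˢ Finset.univ).filter (IsAddable l)

open Classical in
/-- The finite set of removable nodes. -/
noncomputable def removableNodes (l : Multipartition d) : Finset (Node d) :=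
  (diagram l).filter (IsRemovable l)

theorem mem_removableNodes {l : Multipartition d} {g : Node d} :
    g ∈ removableNodes l ↔ IsRemovable l g := by
  classical
  simp only [removableNodes, Finset.mem_filter, and_iff_right_iff_imp]
  exact fun h => h.1

/-- The Young diagram `y` with the cell `x` added, where this is a Young diagram. -/
noncomputable def addCell (y : YoungDiagram) (x : ℕ × ℕ) : YoungDiagram :=
  open Classical in
  if h : IsLowerSet (↑(insert x y.cells) : Set (ℕ × ℕ)) then ⟨insert x y.cells, h⟩ else y

/-- The `d`-partition whose diagram is that of `l` with the addable node `g` added. -/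
noncomputable def addNode (l : Multipartition d) (g : Node d) : Multipartition d :=
  Function.update l g.2.2 (addCell (l g.2.2) (g.1, g.2.1))

theorem IsAddable.isLowerSet {l : Multipartition d} {g : Node d} (h : IsAddable l g) :
    IsLowerSet (↑(insert (g.1, g.2.1) (l g.2.2).cells) : Set (ℕ × ℕ)) := by
  obtain ⟨-, m, hm⟩ := h
  have key : insert (g.1, g.2.1) (l g.2.2).cells = (m g.2.2).cells := by
    ext ⟨x, y⟩
    have := congrArg (fun s => (x, y, g.2.2) ∈ s) hm
    simp only [mem_diagram, Finset.mem_insert, eq_iff_iff] at this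
    rw [YoungDiagram.mem_cells, this, Finset.mem_insert, YoungDiagram.mem_cells]
    refine or_congr ?_ Iff.rfl
    obtain ⟨a, b, c⟩ := g
    simp
  rw [key]
  exact (m g.2.2).isLowerSet

theorem IsAddable.diagram_addNode {l : Multipartition d} {g : Node d} (h : IsAddable l g) :
    diagram (addNode l g) = insert g (diagram l) := by
  have hl := h.isLowerSet
  ext ⟨x, y, c⟩
  obtain ⟨a, b, c'⟩ := g
  simp only [mem_diagram, Finset.mem_insert, addNode, addCell, dif_pos hl]
  by_cases hc : c = c'
  · subst hc
    rw [Function.update_self, ← YoungDiagram.mem_cells]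
    simp [Finset.mem_insert]
  · rw [Function.update_of_ne hc]
    simp [hc]

theorem mem_addableNodes {l : Multipartition d} {g : Node d} :
    g ∈ addableNodes l ↔ IsAddable l g := by
  classical
  simp only [addableNodes, Finset.mem_filter, and_iff_right_iff_imp]
  intro h
  have hl := h.isLowerSet
  obtain ⟨a, b, c⟩ := g
  have hnot : (a, b) ∉ l c := fun hh => h.1 (mem_diagram.2 hh)
  have hcard : (l c).cells.card ≤ rank l :=
    Finset.single_le_sum (f := fun c => (l c).card) (fun _ _ => Nat.zero_le _) (Finset.mem_univ c)
  have hle : ∀ t : Finset (ℕ × ℕ), (∀ z ∈ t, z ≤ (a, b) ∧ z ≠ (a, b)) →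
      t.card ≤ rank l := by
    intro t ht
    refine le_trans (Finset.card_le_card ?_) hcard
    intro z hz
    have h1 : z ∈ (↑(insert (a, b) (l c).cells) : Set (ℕ × ℕ)) :=
      hl (ht z hz).1 (by simp)
    have h2 : z ∈ insert (a, b) (l c).cells := h1
    rcases Finset.mem_insert.1 h2 with h3 | h3
    · exact absurd h3 (ht z hz).2
    · exact h3
  have ha : a ≤ rank l := by
    have := hle ((Finset.range a).image fun i => (i, b)) (by
      intro z hz
      obtain ⟨i, hi, rfl⟩ := Finset.mem_image.1 hz
      rw [Finset.mem_range] at hi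
      exact ⟨⟨hi.le, le_rfl⟩, fun hh => hi.ne (Prod.mk.inj hh).1⟩)
    rwa [Finset.card_image_of_injective _ (fun i j hij => (Prod.mk.inj hij).1),
      Finset.card_range] at this
  have hb : b ≤ rank l := by
    have := hle ((Finset.range b).image fun i => (a, i)) (by
      intro z hz
      obtain ⟨i, hi, rfl⟩ := Finset.mem_image.1 hz
      rw [Finset.mem_range] at hi
      exact ⟨⟨le_rfl, hi.le⟩, fun hh => hi.ne (Prod.mk.inj hh).2⟩)
    rwa [Finset.card_image_of_injective _ (fun i j hij => (Prod.mk.inj hij).2),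
      Finset.card_range] at this
  simp only [Finset.mem_product, Finset.mem_range, Finset.mem_univ, and_true]
  omega

/-! The Fock space and the operators `f_i` of the JMMO action -/

/-- The node `g` is above the node `g'` for the FLOTW order. -/
def IsAbove (v : Fin d → ℕ) (g g' : Node d) : Prop :=
  content v g < content v g' ∨ (content v g = content v g' ∧ g'.2.2 < g.2.2)

open Classical in
/-- For an addable `i`-node `g` of `l`, and the `d`-partition `m` obtained by adding it: the number
of addable `i`-nodes of `l` below `g` minus the number of removable `i`-nodes of `m` below `g`. -/
noncomputable def nBelow (e : ℕ) (v : Fin d → ℕ) (i : ZMod e) (l : Multipartition d) (g : Node d) :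
    ℤ :=
  (((addableNodes l).filter fun x => residue e v x = i ∧ IsAbove v g x).card : ℤ) -
    (((removableNodes (addNode l g)).filter fun x => residue e v x = i ∧ IsAbove v g x).card : ℤ)

/-- The Fock space: the `ℂ(q)`-vector space with basis the set of all `d`-partitions. -/
abbrev Fock (d : ℕ) : Type := Multipartition d →₀ RatFunc ℂ

/-- The indeterminate `q`. -/
noncomputable def q : RatFunc ℂ := RatFunc.X

open Classical in
/-- The operator by which the generator `f_i` acts in the JMMO action: `f_i l` is the sum, over the
`d`-partitions `m` obtained from `l` by adding an `i`-node, of `q ^ N(l, m) m`. -/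
noncomputable def fOp (e : ℕ) (v : Fin d → ℕ) (i : ZMod e) : Module.End (RatFunc ℂ) (Fock d) :=
  Finsupp.linearCombination (RatFunc ℂ) fun l : Multipartition d =>
    ∑ g ∈ (addableNodes l).filter (fun g => residue e v g = i),
      Finsupp.single (addNode l g) (q ^ nBelow e v i l g)

/-- The quantum integer `[j]_q`. -/
noncomputable def qInt (j : ℕ) : RatFunc ℂ := (q ^ j - (q ^ j)⁻¹) / (q - q⁻¹)

/-- The quantum factorial `[j]_q! = [1]_q [2]_q ⋯ [j]_q`. -/
noncomputable def qFactorial (j : ℕ) : RatFunc ℂ := ∏ t ∈ Finset.Icc 1 j, qInt t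

/-- The divided power `f_i^(a) = f_i^a / [a]_q!`. -/
noncomputable def fDiv (e : ℕ) (v : Fin d → ℕ) (i : ZMod e) (a : ℕ) :
    Module.End (RatFunc ℂ) (Fock d) :=
  (qFactorial a)⁻¹ • (fOp e v i) ^ a

/-- For `L = [(i_1, a_1), …, (i_s, a_s)]`, the vector `f_{i_s}^(a_s) ⋯ f_{i_1}^(a_1) ∅`. -/
noncomputable def applyDiv (e : ℕ) (v : Fin d → ℕ) (L : List (ZMod e × ℕ)) : Fock d :=
  L.foldl (fun x p => fDiv e v p.1 p.2 x) (Finsupp.single (emptyMP d) 1)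

/-- The embedding of `ℤ[q, q⁻¹]` into `ℂ(q)`. -/
noncomputable def laurentToRatFunc : ℤ[T;T⁻¹] →+* RatFunc ℂ :=
  LaurentPolynomial.eval₂ (Int.castRingHom (RatFunc ℂ))
    (Units.mk0 q (show q ≠ 0 from RatFunc.X_ne_zero))

/-! FLOTW multipartitions and their `a`-sequences -/

/-- `g` is the node at the right end of a (nonzero) part; the length of this part is `g.2.1 + 1`. -/
def IsRowEnd (l : Multipartition d) (g : Node d) : Prop := g.2.1 + 1 = (l g.2.2).rowLen g.1

/-- FLOTW `d`-partitions associated with `{e; v_0, …, v_{d-1}}`, for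
`0 ≤ v_0 ≤ ⋯ ≤ v_{d-1} < e` (so that the subtractions below are not truncated). -/
structure IsFLOTW (e : ℕ) (v : Fin d → ℕ) (l : Multipartition d) : Prop where
  next : ∀ j j' : Fin d, (j' : ℕ) = (j : ℕ) + 1 →
    ∀ i : ℕ, (l j').rowLen (i + (v j' - v j)) ≤ (l j).rowLen i
  wrap : ∀ j j' : Fin d, (j : ℕ) = 0 → (j' : ℕ) + 1 = d →
    ∀ i : ℕ, (l j).rowLen (i + (e + v j - v j')) ≤ (l j').rowLen i
  missing : ∀ k : ℕ, 0 < k →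
    ∃ r : ZMod e, ∀ g : Node d, IsRowEnd l g → g.2.1 + 1 = k → residue e v g ≠ r

/-- The maximal length of a part. -/
def maxLen (l : Multipartition d) : ℕ := Finset.univ.sup fun c => (l c).rowLen 0

open Classical in
/-- The removable `k`-nodes that lie on a part strictly longer than every part whose right end
is a `(k-1)`-node. -/
noncomputable def strip (e : ℕ) (v : Fin d → ℕ) (l : Multipartition d) (k : ZMod e) :
    Finset (Node d) :=
  (removableNodes l).filter fun x => residue e v x = k ∧
    ∀ g : Node d, IsRowEnd l g → residue e v g = k - 1 → g.2.1 + 1 < x.2.1 + 1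

/-- `IsASequence e v l L`: the sequence of residues `L` is an `a`-sequence of `l`.  In the recursive
step, `k` is the residue of a removable node on a part of maximal length such that no part of
maximal length ends in a `(k-1)`-node; the nodes of `strip e v l k` are removed. -/
inductive IsASequence (e : ℕ) (v : Fin d → ℕ) : Multipartition d → List (ZMod e) → Prop
  | empty : IsASequence e v (emptyMP d) []
  | step (l l' : Multipartition d) (k : ZMod e) (L : List (ZMod e))
      (hk : ∃ x : Node d, IsRemovable l x ∧ x.2.1 + 1 = maxLen l ∧ residue e v x = k)
      (hk' : ∀ g : Node d, IsRowEnd l g → g.2.1 + 1 = maxLen l → residue e v g ≠ k - 1)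
      (hl' : diagram l' = diagram l \ strip e v l k)
      (hL : IsASequence e v l' L) :
      IsASequence e v l (L ++ List.replicate (strip e v l k).card k)

/-! The `a`-value -/

/-- The rational number `m^(j) = v_j - j e / d + e`. -/
def shift (e : ℕ) (v : Fin d → ℕ) (j : Fin d) : ℚ :=
  (v j : ℚ) - (j : ℕ) * (e : ℚ) / (d : ℚ) + (e : ℚ)

/-- The entries `B'_p^(j) = λ_p^(j) - p + n + m^(j)`, `n` the rank, with `p = a + 1`. -/
def entry (e : ℕ) (v : Fin d → ℕ) (l : Multipartition d) (j : Fin d) (a : ℕ) : ℚ :=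
  ((l j).rowLen a : ℚ) - ((a : ℚ) + 1) + (rank l : ℚ) + shift e v j

/-- The rational number `a_1(l)`; here `k` runs over the integers with `1 ≤ k ≤ B'_p^(i)`. -/
def aOne (e : ℕ) (v : Fin d → ℕ) (l : Multipartition d) : ℚ :=
  (∑ i : Fin d, ∑ j : Fin d, ∑ a ∈ Finset.range (rank l), ∑ b ∈ Finset.range (rank l),
    if i < j ∨ (i = j ∧ entry e v l j b < entry e v l i a) then
      min (entry e v l i a) (entry e v l j b) else 0) -
  ∑ i : Fin d, ∑ j : Fin d, ∑ a ∈ Finset.range (rank l),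
    ∑ k ∈ Finset.Icc 1 ⌊entry e v l i a⌋₊, min (k : ℚ) (shift e v j)

/-- The `a`-value `a(l) = a_1(l) + f(n)`, `n` the rank of `l`, for a normalisation `f`. -/
def aValue (e : ℕ) (v : Fin d → ℕ) (f : ℕ → ℚ) (l : Multipartition d) : ℚ :=
  aOne e v l + f (rank l)

end JMMO

open scoped LaurentPolynomial

namespace JMMO

variable {d : ℕ}

/-! Diagrams as finite sets of nodes -/

/-! The neighbours of a `k`-node have residues `k ± 1`, so if `1 ≠ 0` in `ZMod e`, adding one
`k`-node does not affect the other addable `k`-nodes. Hence `f_k^(a)` sends a `d`-partition to the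
sum of all its extensions by `a` addable `k`-nodes, each weighted by a power of `q` (`fDiv_single`),
and integrality is clear.

For triangularity, count the `k`-nodes in columns `≥ t` (`colCount`). A strip consists of removable
`k`-nodes to the right of all row ends of residue `k - 1`. Beyond the first strip column, `l`
therefore has as many `k`-nodes as its `(k-1)`-nodes one column to the left allow. So every `m` in
the product satisfies `colCount m ≤ colCount l` (`colCount_addNodes_le`), and `l` itself arises only
by adding the strip to `l'` (`addNodes_eq_imp_eq_strip`). The power of `q` there is `q ^ 0`, by the
FLOTW inequalities (`IsFLOTW.stripExponent_eq_zero`).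

The passage to the `a`-value uses `position`, equal to `d * content - e * c`. The FLOTW inequalities
make the nodes of `l` of a given residue closed under moving weakly left and weakly up in position
(`IsFLOTW.mem_of_position_le`). So a bound by columns becomes a bound by positions
(`IsFLOTW.posCount_le`): `l` has at least as many nodes of position `≥ T` as `m`, for every `T`,
with equality throughout only if `m = l`.

Finally, `d` times an entry of `B'` is an integer bead. The sum of minima over pairs of beads is a
sum of squares of bead counts, and summation by parts shows that it is no larger for `l` than for
`m`. The subtracted sum is, up to a constant, a monotone function of positions summed over nodes, so
it is no smaller for `l`. Thus `a(l) ≤ a(m)`, and equality forces all position counts to agree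
(`aOne_le`). -/

theorem diagram_injective : Function.Injective (diagram : Multipartition d → Finset (Node d)) := by
  intro l m h
  funext c
  ext ⟨a, b⟩
  have := congrArg (fun s => (a, b, c) ∈ s) h
  simpa only [mem_diagram, eq_iff_iff, YoungDiagram.mem_cells] using this

theorem card_diagram (l : Multipartition d) : (diagram l).card = rank l := by
  rw [diagram, Finset.card_biUnion]
  · refine Finset.sum_congr rfl fun c _ => ?_
    rw [Finset.card_image_of_injective]
    rintro ⟨a, b⟩ ⟨a', b'⟩ h
    simp only [Prod.mk.injEq, and_true] at h
    simp [h]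
  · intro c _ c' _ hcc
    rw [Function.onFun, Finset.disjoint_left]
    rintro ⟨a, b, c''⟩ h h'
    simp only [Finset.mem_image, Prod.mk.injEq] at h h'
    obtain ⟨_, _, _, _, rfl⟩ := h
    obtain ⟨_, _, _, _, rfl⟩ := h'
    exact hcc rfl

theorem mem_diagram_mono {l : Multipartition d} {a b a' b' : ℕ} {c : Fin d}
    (h : (a, b, c) ∈ diagram l) (ha : a' ≤ a) (hb : b' ≤ b) : (a', b', c) ∈ diagram l := by
  rw [mem_diagram] at h ⊢
  exact (l c).up_left_mem ha hb h

theorem mem_diagram_iff_lt_rowLen {l : Multipartition d} {a b : ℕ} {c : Fin d} :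
    (a, b, c) ∈ diagram l ↔ b < (l c).rowLen a := by
  rw [mem_diagram, YoungDiagram.mem_iff_lt_rowLen]

/-- A finite set of nodes that is the diagram of a `d`-partition. -/
def IsDiagram (S : Finset (Node d)) : Prop :=
  ∀ a b c, (a, b, c) ∈ S → ∀ a' b', a' ≤ a → b' ≤ b → (a', b', c) ∈ S

theorem exists_diagram_eq_iff {S : Finset (Node d)} :
    (∃ m : Multipartition d, diagram m = S) ↔ IsDiagram S := by
  classical
  constructor
  · rintro ⟨m, rfl⟩ a b c h a' b' ha hb
    exact mem_diagram_mono h ha hb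
  · intro h
    refine ⟨fun c => ⟨(S.filter fun g => g.2.2 = c).image fun g => (g.1, g.2.1), ?_⟩, ?_⟩
    · rintro ⟨a, b⟩ ⟨a', b'⟩ hle hab
      simp only [Finset.coe_image, Set.mem_image, Finset.mem_coe, Finset.mem_filter,
        Prod.mk.injEq, Prod.exists] at hab ⊢
      obtain ⟨x, y, z, ⟨hS, rfl⟩, rfl, rfl⟩ := hab
      exact ⟨a', b', z, ⟨h _ _ _ hS _ _ hle.1 hle.2, rfl⟩, rfl, rfl⟩
    · ext ⟨a, b, c⟩
      rw [mem_diagram, ← YoungDiagram.mem_cells]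
      simp

theorem isAddable_iff {l : Multipartition d} {a b : ℕ} {c : Fin d} :
    IsAddable l (a, b, c) ↔ (a, b, c) ∉ diagram l ∧
      (∀ a', a = a' + 1 → (a', b, c) ∈ diagram l) ∧
      (∀ b', b = b' + 1 → (a, b', c) ∈ diagram l) := by
  rw [IsAddable, exists_diagram_eq_iff]
  refine and_congr_right fun hn => ⟨fun h => ⟨?_, ?_⟩, ?_⟩
  · rintro a' rfl
    have := h _ _ _ (Finset.mem_insert_self _ _) a' b (by omega) le_rfl
    simpa using this
  · rintro b' rfl
    have := h _ _ _ (Finset.mem_insert_self _ _) a b' le_rfl (by omega)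
    simpa using this
  · rintro ⟨h1, h2⟩ x y z hx x' y' hxx hyy
    rw [Finset.mem_insert] at hx ⊢
    rcases hx with hx | hx
    · simp only [Prod.mk.injEq] at hx
      obtain ⟨rfl, rfl, rfl⟩ := hx
      rcases hxx.eq_or_lt with rfl | hlt
      · rcases hyy.eq_or_lt with rfl | hlt
        · exact Or.inl rfl
        · exact Or.inr (mem_diagram_mono (h2 (y - 1) (by omega)) le_rfl (by omega))
      · exact Or.inr (mem_diagram_mono (h1 (x - 1) (by omega)) (by omega) hyy)
    · exact Or.inr (mem_diagram_mono hx hxx hyy)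

theorem isRemovable_iff {l : Multipartition d} {a b : ℕ} {c : Fin d} :
    IsRemovable l (a, b, c) ↔ (a, b, c) ∈ diagram l ∧ (a + 1, b, c) ∉ diagram l ∧
      (a, b + 1, c) ∉ diagram l := by
  rw [IsRemovable, exists_diagram_eq_iff]
  refine and_congr_right fun hn => ⟨fun h => ⟨fun h' => ?_, fun h' => ?_⟩, ?_⟩
  · exact Finset.notMem_erase (a, b, c) (diagram l)
      (h (a + 1) b c (Finset.mem_erase.2 ⟨by simp, h'⟩) a b (by omega) le_rfl)
  · exact Finset.notMem_erase (a, b, c) (diagram l)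
      (h a (b + 1) c (Finset.mem_erase.2 ⟨by simp, h'⟩) a b le_rfl (by omega))
  · rintro ⟨h1, h2⟩ x y z hx x' y' hxx hyy
    rw [Finset.mem_erase] at hx ⊢
    refine ⟨fun h => ?_, mem_diagram_mono hx.2 hxx hyy⟩
    simp only [Prod.mk.injEq] at h
    obtain ⟨rfl, rfl, rfl⟩ := h
    rcases hxx.eq_or_lt with rfl | hlt
    · rcases hyy.eq_or_lt with rfl | hlt
      · exact hx.1 rfl
      · exact h2 (mem_diagram_mono hx.2 le_rfl hlt)
    · exact h1 (mem_diagram_mono hx.2 hlt hyy)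

theorem isRowEnd_iff {l : Multipartition d} {a b : ℕ} {c : Fin d} :
    IsRowEnd l (a, b, c) ↔ (a, b, c) ∈ diagram l ∧ (a, b + 1, c) ∉ diagram l := by
  rw [mem_diagram_iff_lt_rowLen, mem_diagram_iff_lt_rowLen, IsRowEnd]
  dsimp only
  omega

theorem IsRemovable.isRowEnd {l : Multipartition d} {g : Node d} (h : IsRemovable l g) :
    IsRowEnd l g := by
  obtain ⟨a, b, c⟩ := g
  rw [isRemovable_iff] at h
  exact isRowEnd_iff.2 ⟨h.1, h.2.2⟩

theorem rowLen_le_maxLen (l : Multipartition d) (a : ℕ) (c : Fin d) :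
    (l c).rowLen a ≤ maxLen l :=
  ((l c).rowLen_anti 0 a (Nat.zero_le a)).trans
    (Finset.le_sup (f := fun c => (l c).rowLen 0) (Finset.mem_univ c))

section Residue

variable (e : ℕ) (v : Fin d → ℕ)

theorem residue_succ_row (a b : ℕ) (c : Fin d) :
    residue e v (a + 1, b, c) = residue e v (a, b, c) - 1 := by
  simp only [residue, content]
  push_cast
  ring

theorem residue_succ_col (a b : ℕ) (c : Fin d) :
    residue e v (a, b + 1, c) = residue e v (a, b, c) + 1 := by
  simp only [residue, content]
  push_cast
  ring

/-- Since `0 ≤ c < d`, the lexicographic order is that of the single integer `d * content - c`. -/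
theorem isAbove_iff (g g' : Node d) :
    IsAbove v g g' ↔ d * content v g - (g.2.2 : ℕ) < d * content v g' - (g'.2.2 : ℕ) := by
  have h1 := g.2.2.isLt
  have h2 := g'.2.2.isLt
  rw [IsAbove, Fin.lt_def]
  constructor
  · rintro (h | ⟨h, h'⟩)
    · have : (d : ℤ) * (content v g + 1) ≤ d * content v g' :=
        mul_le_mul_of_nonneg_left h (by positivity)
      rw [mul_add] at this
      omega
    · rw [h]
      omega
  · intro h
    rcases lt_trichotomy (content v g) (content v g') with h' | h' | h'
    · exact Or.inl h'
    · rw [h'] at h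
      exact Or.inr ⟨h', by omega⟩
    · have : (d : ℤ) * (content v g' + 1) ≤ d * content v g :=
        mul_le_mul_of_nonneg_left h' (by positivity)
      rw [mul_add] at this
      omega

end Residue

/-! Quantum integers -/

theorem q_ne_zero : q ≠ 0 := RatFunc.X_ne_zero

theorem q_pow_ne_one {n : ℕ} (hn : n ≠ 0) : q ^ n ≠ 1 := by
  intro h
  have h' : algebraMap (Polynomial ℂ) (RatFunc ℂ) (Polynomial.X ^ n) =
      algebraMap (Polynomial ℂ) (RatFunc ℂ) 1 := by
    simpa [q, RatFunc.algebraMap_X] using h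
  have := congrArg Polynomial.natDegree (RatFunc.algebraMap_injective ℂ h')
  rw [Polynomial.natDegree_X_pow, Polynomial.natDegree_one] at this
  exact hn this

theorem q_pow_sub_inv_ne_zero {n : ℕ} (hn : n ≠ 0) : q ^ n - (q ^ n)⁻¹ ≠ 0 := by
  intro h
  have h0 : q ^ n ≠ 0 := pow_ne_zero _ q_ne_zero
  have h' := mul_inv_cancel₀ h0
  rw [← sub_eq_zero.1 h, ← pow_add] at h'
  exact q_pow_ne_one (by omega) h'

theorem q_sub_inv_ne_zero : q - q⁻¹ ≠ 0 := by
  simpa using q_pow_sub_inv_ne_zero one_ne_zero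

theorem qFactorial_ne_zero (a : ℕ) : qFactorial a ≠ 0 :=
  Finset.prod_ne_zero_iff.2 fun _ ht =>
    div_ne_zero (q_pow_sub_inv_ne_zero (by have := (Finset.mem_Icc.1 ht).1; omega))
      q_sub_inv_ne_zero

theorem qFactorial_succ (a : ℕ) : qFactorial (a + 1) = qFactorial a * qInt (a + 1) :=
  Finset.prod_Icc_succ_top (by omega) _

theorem qInt_succ (n : ℕ) : qInt (n + 1) = q ^ n + q⁻¹ * qInt n := by
  have h := q_sub_inv_ne_zero
  have h0 := q_ne_zero
  rw [qInt, qInt, div_eq_iff h, add_mul, mul_assoc, div_mul_cancel₀ _ h, pow_succ]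
  field_simp
  ring

/-- A `q`-count of a finite set by the rank of its elements. -/
theorem sum_zpow_rank {α : Type*} (κ : α → ℤ) (B : Finset α) (hκ : Set.InjOn κ B) :
    ∑ g ∈ B, q ^ (((B.filter fun x => κ x < κ g).card : ℤ) -
      ((B.filter fun x => κ g < κ x).card : ℤ)) = qInt B.card := by
  classical
  -- The largest element contributes `q ^ |s|` and lowers every other exponent by one, matching
  -- `qInt_succ`.
  induction B using Finset.induction_on_max_value κ with
  | empty => simp [qInt]
  | insert a s ha hmax ih =>
    have hlt : ∀ x ∈ s, κ x < κ a := fun x hx =>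
      lt_of_le_of_ne (hmax x hx) fun h => ha <| by
        rw [← hκ (by simp [hx]) (by simp) h]
        exact hx
    rw [Finset.sum_insert ha, Finset.card_insert_of_notMem ha, qInt_succ,
      ← ih (hκ.mono (by simp)), Finset.mul_sum]
    congr 1
    · have h1 : (insert a s).filter (fun x => κ x < κ a) = s := by
        ext x
        simp only [Finset.mem_filter, Finset.mem_insert]
        constructor
        · rintro ⟨rfl | h, h'⟩
          · exact absurd h' (lt_irrefl _)
          · exact h
        · exact fun h => ⟨Or.inr h, hlt x h⟩
      have h2 : (insert a s).filter (fun x => κ a < κ x) = ∅ := by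
        ext x
        simp only [Finset.mem_filter, Finset.mem_insert, Finset.notMem_empty, iff_false, not_and]
        rintro (rfl | h)
        · exact lt_irrefl _
        · exact (hlt x h).not_gt
      rw [h1, h2]
      simp
    · refine Finset.sum_congr rfl fun g hg => ?_
      have hga := hlt g hg
      rw [Finset.filter_insert, if_neg hga.not_gt, Finset.filter_insert, if_pos hga,
        Finset.card_insert_of_notMem (by simp [ha]), ← zpow_neg_one, ← zpow_add₀ q_ne_zero]
      congr 1
      push_cast
      ring

/-! Adding a set of nodes of the same residue -/

open Classical in
/-- The `d`-partition obtained from `l` by adding the nodes of `A`, where this makes sense. -/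
noncomputable def addNodes (l : Multipartition d) (A : Finset (Node d)) : Multipartition d :=
  if h : ∃ m : Multipartition d, diagram m = diagram l ∪ A then h.choose else l

open Classical in
/-- The addable nodes of residue `k`. -/
noncomputable def kAddable (e : ℕ) (v : Fin d → ℕ) (k : ZMod e) (l : Multipartition d) :
    Finset (Node d) :=
  (addableNodes l).filter fun x => residue e v x = k

open Classical in
/-- The removable nodes of residue `k`. -/
noncomputable def kRemovable (e : ℕ) (v : Fin d → ℕ) (k : ZMod e) (l : Multipartition d) :
    Finset (Node d) :=
  (removableNodes l).filter fun x => residue e v x = k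

section

variable {e : ℕ} {v : Fin d → ℕ} {k : ZMod e} {l : Multipartition d} {A : Finset (Node d)}

theorem mem_kAddable {g : Node d} :
    g ∈ kAddable e v k l ↔ IsAddable l g ∧ residue e v g = k := by
  rw [kAddable, Finset.mem_filter, mem_addableNodes]

theorem mem_kRemovable {g : Node d} :
    g ∈ kRemovable e v k l ↔ IsRemovable l g ∧ residue e v g = k := by
  rw [kRemovable, Finset.mem_filter, mem_removableNodes]

-- The neighbours required by an addable node already lie in `l`, so any set of addable nodes can be
-- added at once.
open Classical in
theorem diagram_addNodes (hA : A ⊆ kAddable e v k l) :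
    diagram (addNodes l A) = diagram l ∪ A := by
  have h : ∃ m : Multipartition d, diagram m = diagram l ∪ A := by
    rw [exists_diagram_eq_iff]
    intro a b c h a' b' ha hb
    rw [Finset.mem_union] at h ⊢
    rcases h with h | h
    · exact Or.inl (mem_diagram_mono h ha hb)
    · obtain ⟨-, m, hm⟩ := (mem_kAddable.1 (hA h)).1
      have h1 : (a', b', c) ∈ diagram m :=
        mem_diagram_mono (by rw [hm]; exact Finset.mem_insert_self _ _) ha hb
      rw [hm, Finset.mem_insert] at h1
      rcases h1 with h1 | h1
      · rw [h1]
        exact Or.inr h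
      · exact Or.inl h1
  rw [addNodes, dif_pos h]
  exact h.choose_spec

theorem disjoint_of_subset_kAddable (hA : A ⊆ kAddable e v k l) : Disjoint (diagram l) A :=
  Finset.disjoint_right.2 fun _ hg => (mem_kAddable.1 (hA hg)).1.1

theorem residue_of_subset_kAddable (hA : A ⊆ kAddable e v k l) {g : Node d} (hg : g ∈ A) :
    residue e v g = k := (mem_kAddable.1 (hA hg)).2

theorem mem_addNodes_of_residue_ne (hA : A ⊆ kAddable e v k l) {g : Node d}
    (hg : residue e v g ≠ k) : g ∈ diagram (addNodes l A) ↔ g ∈ diagram l := by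
  classical
  rw [diagram_addNodes hA, Finset.mem_union, or_iff_left]
  exact fun h => hg (residue_of_subset_kAddable hA h)

theorem rank_addNodes (hA : A ⊆ kAddable e v k l) :
    rank (addNodes l A) = rank l + A.card := by
  classical
  rw [← card_diagram, diagram_addNodes hA,
    Finset.card_union_of_disjoint (disjoint_of_subset_kAddable hA), card_diagram]

-- The neighbours of a `k`-node have residues `k ± 1 ≠ k`, so adding nodes of `A` neither creates
-- nor blocks addable `k`-nodes outside `A`.
open Classical in
theorem kAddable_addNodes (h1 : (1 : ZMod e) ≠ 0) (hA : A ⊆ kAddable e v k l) :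
    kAddable e v k (addNodes l A) = kAddable e v k l \ A := by
  ext ⟨a, b, c⟩
  rw [Finset.mem_sdiff, mem_kAddable, mem_kAddable, isAddable_iff, isAddable_iff,
    diagram_addNodes hA, Finset.mem_union, not_or]
  by_cases hk : residue e v (a, b, c) = k
  · have hr : ∀ a', a = a' + 1 → (a', b, c) ∉ A := by
      rintro a' rfl h
      rw [residue_succ_row, residue_of_subset_kAddable hA h] at hk
      exact h1 (by linear_combination -hk)
    have hc : ∀ b', b = b' + 1 → (a, b', c) ∉ A := by
      rintro b' rfl h
      rw [residue_succ_col, residue_of_subset_kAddable hA h] at hk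
      exact h1 (by linear_combination hk)
    have hr' : (∀ a', a = a' + 1 → (a', b, c) ∈ diagram l ∪ A) ↔
        ∀ a', a = a' + 1 → (a', b, c) ∈ diagram l := by
      refine forall₂_congr fun a' ha' => ?_
      rw [Finset.mem_union, or_iff_left (hr a' ha')]
    have hc' : (∀ b', b = b' + 1 → (a, b', c) ∈ diagram l ∪ A) ↔
        ∀ b', b = b' + 1 → (a, b', c) ∈ diagram l := by
      refine forall₂_congr fun b' hb' => ?_
      rw [Finset.mem_union, or_iff_left (hc b' hb')]
    rw [hr', hc']
    tauto
  · tauto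

open Classical in
theorem kRemovable_addNodes (h1 : (1 : ZMod e) ≠ 0) (hA : A ⊆ kAddable e v k l) :
    kRemovable e v k (addNodes l A) = kRemovable e v k l ∪ A := by
  ext ⟨a, b, c⟩
  rw [Finset.mem_union, mem_kRemovable, mem_kRemovable, isRemovable_iff, isRemovable_iff]
  by_cases hk : residue e v (a, b, c) = k
  · rw [mem_addNodes_of_residue_ne hA (g := (a + 1, b, c)), mem_addNodes_of_residue_ne hA
      (g := (a, b + 1, c)), diagram_addNodes hA, Finset.mem_union]
    · have : (a, b, c) ∈ A → (a + 1, b, c) ∉ diagram l ∧ (a, b + 1, c) ∉ diagram l := by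
        intro h
        have hn := (mem_kAddable.1 (hA h)).1.1
        exact ⟨fun h' => hn (mem_diagram_mono h' (by omega) le_rfl),
          fun h' => hn (mem_diagram_mono h' le_rfl (by omega))⟩
      tauto
    · rw [residue_succ_col, hk]
      exact fun h => h1 (by linear_combination h)
    · rw [residue_succ_row, hk]
      exact fun h => h1 (by linear_combination -h)
  · have := fun h => hk (residue_of_subset_kAddable hA (g := (a, b, c)) h)
    tauto

open Classical in
theorem addNode_addNodes (h1 : (1 : ZMod e) ≠ 0) (hA : A ⊆ kAddable e v k l) {g : Node d}
    (hg : g ∈ kAddable e v k l \ A) : addNode (addNodes l A) g = addNodes l (insert g A) := by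
  apply diagram_injective
  have hg' := hg
  rw [← kAddable_addNodes h1 hA, mem_kAddable] at hg'
  rw [hg'.1.diagram_addNode, diagram_addNodes hA, diagram_addNodes
    (Finset.insert_subset (Finset.mem_sdiff.1 hg).1 hA), Finset.union_insert]

theorem addNodes_empty : addNodes l ∅ = l := by
  apply diagram_injective
  classical
  rw [diagram_addNodes (e := 0) (v := fun _ => 0) (k := 0) (Finset.empty_subset _),
    Finset.union_empty]

/-- Two addable nodes of `l` on the same diagonal of the same component are equal. -/
theorem isAddable_injOn :
    Set.InjOn (fun g : Node d => d * content v g - (g.2.2 : ℕ)) {g | IsAddable l g} := by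
  rintro ⟨a, b, c⟩ hg ⟨a', b', c'⟩ hg' h
  have h1 := c.isLt
  have h2 := c'.isLt
  have hcc := (isAbove_iff v (a, b, c) (a', b', c')).not.2 (by dsimp only at h ⊢; omega)
  have hcc' := (isAbove_iff v (a', b', c') (a, b, c)).not.2 (by dsimp only at h ⊢; omega)
  simp only [IsAbove, not_or, not_and, not_lt] at hcc hcc'
  have hcont := le_antisymm hcc'.1 hcc.1
  have hc : c = c' := le_antisymm (hcc.2 hcont) (hcc'.2 hcont.symm)
  subst hc
  simp only [content] at hcont
  rw [Set.mem_ofPred_eq, isAddable_iff] at hg hg'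
  rcases lt_trichotomy a a' with hlt | rfl | hlt
  · exact absurd (mem_diagram_mono (hg'.2.2 (b' - 1) (by omega)) hlt.le
      (show b ≤ b' - 1 by omega)) hg.1
  · have : b = b' := by omega
    rw [this]
  · exact absurd (mem_diagram_mono (hg.2.2 (b - 1) (by omega)) hlt.le
      (show b' ≤ b - 1 by omega)) hg'.1

open Classical in
theorem sum_zpow_above_sub_below {B : Finset (Node d)} (hB : B ⊆ kAddable e v k l) :
    ∑ g ∈ B, q ^ (((B.filter fun x => IsAbove v x g).card : ℤ) -
      ((B.filter fun x => IsAbove v g x).card : ℤ)) = qInt B.card := by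
  rw [← sum_zpow_rank (fun g : Node d => d * content v g - (g.2.2 : ℕ)) B
    ((isAddable_injOn (v := v) (l := l)).mono fun g hg => (mem_kAddable.1 (hB hg)).1)]
  simp only [isAbove_iff]

end

/-! The divided powers -/

section

variable (e : ℕ) (v : Fin d → ℕ) (k : ZMod e) (l : Multipartition d)

open Classical in
/-- The exponent of `q` in the coefficient of `addNodes l A` in `f_k^(a) l`. -/
noncomputable def stripExponent (A : Finset (Node d)) : ℤ :=
  ∑ g ∈ A, ((((kAddable e v k l \ A).filter fun x => IsAbove v g x).card : ℤ) -
    (((kRemovable e v k l).filter fun x => IsAbove v g x).card : ℤ))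

variable {e v k l}

open Classical in
theorem nBelow_addNodes (h1 : (1 : ZMod e) ≠ 0) {A : Finset (Node d)}
    (hA : A ⊆ kAddable e v k l) {g : Node d} (hg : g ∈ kAddable e v k l \ A) :
    nBelow e v k (addNodes l A) g =
      (((kAddable e v k l \ A).filter fun x => IsAbove v g x).card : ℤ) -
      (((kRemovable e v k l ∪ insert g A).filter fun x => IsAbove v g x).card : ℤ) := by
  rw [nBelow, addNode_addNodes h1 hA hg, ← kAddable_addNodes h1 hA, ← kRemovable_addNodes h1
    (Finset.insert_subset (Finset.mem_sdiff.1 hg).1 hA), kAddable, kRemovable,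
    Finset.filter_filter, Finset.filter_filter]

theorem not_isAbove_self (v : Fin d → ℕ) (g : Node d) : ¬ IsAbove v g g := by
  simp [IsAbove]

-- Compares adding `g` last with the symmetric exponent of `B`. While `g` is still missing, it
-- counts as an addable node below each element of `B` above it; when it is added, the elements of
-- `B` below it count as removable. Summed over `g`, the correction is the quantum integer of
-- `sum_zpow_above_sub_below`.
open Classical in
theorem stripExponent_erase_add_nBelow (h1 : (1 : ZMod e) ≠ 0) {B : Finset (Node d)}
    (hB : B ⊆ kAddable e v k l) {g : Node d} (hg : g ∈ B) :
    stripExponent e v k l (B.erase g) + nBelow e v k (addNodes l (B.erase g)) g =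
      stripExponent e v k l B + (((B.filter fun x => IsAbove v x g).card : ℤ) -
      ((B.filter fun x => IsAbove v g x).card : ℤ)) := by
  have hgP := hB hg
  have hsd : kAddable e v k l \ B.erase g = insert g (kAddable e v k l \ B) := by
    ext x
    simp only [Finset.mem_sdiff, Finset.mem_erase, Finset.mem_insert]
    by_cases hx : x = g
    · subst hx
      simp [hgP]
    · simp [hx]
  have hcard : ∀ y : Node d, (((insert g (kAddable e v k l \ B)).filter
      fun x => IsAbove v y x).card : ℤ) =
      ((kAddable e v k l \ B).filter fun x => IsAbove v y x).card +
        if IsAbove v y g then 1 else 0 := by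
    intro y
    rw [Finset.filter_insert]
    split_ifs with h
    · rw [Finset.card_insert_of_notMem (by simp [hg])]
      push_cast
      rfl
    · simp
  have hdisj : Disjoint (kRemovable e v k l) B := by
    rw [Finset.disjoint_left]
    exact fun x hx hx' => (mem_kAddable.1 (hB hx')).1.1 (mem_kRemovable.1 hx).1.1
  rw [nBelow_addNodes h1 ((Finset.erase_subset g B).trans hB)
    (by rw [hsd]; exact Finset.mem_insert_self _ _), Finset.insert_erase hg, hsd, hcard,
    Finset.filter_union, Finset.card_union_of_disjoint
      (hdisj.mono (Finset.filter_subset _ _) (Finset.filter_subset _ _)),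
    if_neg (not_isAbove_self v g), stripExponent, stripExponent, hsd]
  simp only [hcard]
  rw [← Finset.add_sum_erase B _ hg]
  have hsum : ∑ x ∈ B.erase g, (if IsAbove v x g then 1 else 0 : ℤ) =
      ((B.filter fun x => IsAbove v x g).card : ℤ) := by
    rw [Finset.sum_boole, Finset.filter_erase, Finset.erase_eq_of_notMem]
    simp [not_isAbove_self]
  rw [← hsum]
  simp only [Finset.sum_sub_distrib, Finset.sum_add_distrib]
  push_cast
  ring

open Classical in
theorem fOp_single (c : RatFunc ℂ) :
    fOp e v k (Finsupp.single l c) =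
      ∑ g ∈ kAddable e v k l, Finsupp.single (addNode l g) (c * q ^ nBelow e v k l g) := by
  rw [fOp, Finsupp.linearCombination_single, Finset.smul_sum]
  simp only [Finsupp.smul_single, smul_eq_mul, kAddable]

-- A set `B` of `a + 1` nodes is reached once for each choice of its last node `g`, and these
-- contributions add up to a factor `[a + 1]_q`.
open Classical in
theorem fOp_pow_single (h1 : (1 : ZMod e) ≠ 0) (a : ℕ) :
    (fOp e v k ^ a) (Finsupp.single l 1) =
      ∑ A ∈ (kAddable e v k l).powersetCard a,
        Finsupp.single (addNodes l A) (qFactorial a * q ^ stripExponent e v k l A) := by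
  induction a with
  | zero => simp [addNodes_empty, qFactorial, stripExponent]
  | succ a ih =>
    rw [pow_succ', Module.End.mul_apply, ih, map_sum]
    have hL : ∀ A ∈ (kAddable e v k l).powersetCard a,
        fOp e v k (Finsupp.single (addNodes l A)
          (qFactorial a * q ^ stripExponent e v k l A)) =
        ∑ g ∈ kAddable e v k l \ A, Finsupp.single (addNodes l (insert g A))
          (qFactorial a * q ^ (stripExponent e v k l A + nBelow e v k (addNodes l A) g)) := by
      intro A hA
      have hA' := (Finset.mem_powersetCard.1 hA).1
      rw [fOp_single, kAddable_addNodes h1 hA']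
      refine Finset.sum_congr rfl fun g hg => ?_
      rw [addNode_addNodes h1 hA' hg, zpow_add₀ q_ne_zero, mul_assoc]
    have hR : ∀ B ∈ (kAddable e v k l).powersetCard (a + 1),
        Finsupp.single (addNodes l B) (qFactorial (a + 1) * q ^ stripExponent e v k l B) =
        ∑ g ∈ B, Finsupp.single (addNodes l B) (qFactorial a *
          q ^ (stripExponent e v k l (B.erase g) +
            nBelow e v k (addNodes l (B.erase g)) g)) := by
      intro B hB
      obtain ⟨hB', hcard⟩ := Finset.mem_powersetCard.1 hB
      rw [← Finsupp.single_finsetSum, ← Finset.mul_sum, Finset.sum_congr rfl fun g hg => by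
        rw [stripExponent_erase_add_nBelow h1 hB' hg, zpow_add₀ q_ne_zero], ← Finset.mul_sum,
        sum_zpow_above_sub_below hB', hcard, qFactorial_succ]
      congr 1
      ring
    rw [Finset.sum_congr rfl hL, Finset.sum_congr rfl hR, Finset.sum_sigma', Finset.sum_sigma']
    refine Finset.sum_bij' (fun p _ => ⟨insert p.2 p.1, p.2⟩) (fun p _ => ⟨p.1.erase p.2, p.2⟩)
      ?_ ?_ ?_ ?_ ?_
    · rintro ⟨A, g⟩ h
      simp only [Finset.mem_sigma, Finset.mem_powersetCard, Finset.mem_sdiff] at h ⊢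
      exact ⟨⟨Finset.insert_subset h.2.1 h.1.1, by
        rw [Finset.card_insert_of_notMem h.2.2, h.1.2]⟩, Finset.mem_insert_self _ _⟩
    · rintro ⟨B, g⟩ h
      simp only [Finset.mem_sigma, Finset.mem_powersetCard, Finset.mem_sdiff] at h ⊢
      exact ⟨⟨(Finset.erase_subset _ _).trans h.1.1, by
        rw [Finset.card_erase_of_mem h.2, h.1.2]; rfl⟩, h.1.1 h.2, Finset.notMem_erase _ _⟩
    · rintro ⟨A, g⟩ h
      simp only [Finset.mem_sigma, Finset.mem_sdiff] at h
      simp [Finset.erase_insert h.2.2]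
    · rintro ⟨B, g⟩ h
      simp only [Finset.mem_sigma] at h
      simp [Finset.insert_erase h.2]
    · rintro ⟨A, g⟩ h
      simp only [Finset.mem_sigma, Finset.mem_sdiff] at h
      simp [Finset.erase_insert h.2.2]

open Classical in
theorem fDiv_single (h1 : (1 : ZMod e) ≠ 0) (a : ℕ) :
    fDiv e v k a (Finsupp.single l 1) =
      ∑ A ∈ (kAddable e v k l).powersetCard a,
        Finsupp.single (addNodes l A) (q ^ stripExponent e v k l A) := by
  rw [fDiv, LinearMap.smul_apply, fOp_pow_single h1, Finset.smul_sum]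
  refine Finset.sum_congr rfl fun A _ => ?_
  rw [Finsupp.smul_single, smul_eq_mul, inv_mul_cancel_left₀ (qFactorial_ne_zero a)]

open Classical in
theorem fDiv_apply (h1 : (1 : ZMod e) ≠ 0) (a : ℕ) (U : Fock d) (m : Multipartition d) :
    fDiv e v k a U m = ∑ l ∈ U.support, U l * ∑ A ∈ (kAddable e v k l).powersetCard a,
      if addNodes l A = m then q ^ stripExponent e v k l A else 0 := by
  conv_lhs => rw [← Finsupp.sum_single U]
  rw [Finsupp.sum, map_sum, Finsupp.finsetSum_apply]
  refine Finset.sum_congr rfl fun l _ => ?_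
  rw [show Finsupp.single l (U l) = U l • Finsupp.single l (1 : RatFunc ℂ) by simp, map_smul,
    fDiv_single h1, Finsupp.smul_apply, Finsupp.finsetSum_apply, smul_eq_mul]
  simp only [Finsupp.single_apply]

end

/-! Removing the strip of a step of an `a`-sequence -/

section Strip

variable {e : ℕ} {v : Fin d → ℕ} {k : ZMod e} {l l' : Multipartition d}

theorem mem_strip {g : Node d} : g ∈ strip e v l k ↔ IsRemovable l g ∧ residue e v g = k ∧
    ∀ h : Node d, IsRowEnd l h → residue e v h = k - 1 → h.2.1 < g.2.1 := by
  simp only [strip, Finset.mem_filter, mem_removableNodes, Nat.add_lt_add_iff_right]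

theorem strip_subset : strip e v l k ⊆ diagram l := fun _ hg => (mem_strip.1 hg).1.1

theorem IsRowEnd.isRemovable_or {a b : ℕ} {c : Fin d} (h : IsRowEnd l (a, b, c)) :
    IsRemovable l (a, b, c) ∨ IsRowEnd l (a + 1, b, c) := by
  rw [isRemovable_iff, isRowEnd_iff]
  rw [isRowEnd_iff] at h
  by_cases h' : (a + 1, b, c) ∈ diagram l
  · exact Or.inr ⟨h', fun h'' => h.2 (mem_diagram_mono h'' (by omega) le_rfl)⟩
  · exact Or.inl ⟨h.1, h', h.2⟩

/-- Removability is automatic: otherwise the next row has the same length and ends in residue `k -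
1`, against the bound. So membership of a row end in the strip depends only on its residue and
column. -/
theorem IsRowEnd.mem_strip {g : Node d} (h : IsRowEnd l g) (hg : residue e v g = k)
    (hlt : ∀ h : Node d, IsRowEnd l h → residue e v h = k - 1 → h.2.1 < g.2.1) :
    g ∈ strip e v l k := by
  obtain ⟨a, b, c⟩ := g
  refine JMMO.mem_strip.2 ⟨h.isRemovable_or.resolve_right fun h' => ?_, hg, hlt⟩
  exact lt_irrefl _ (hlt (a + 1, b, c) h' (by rw [residue_succ_row, hg]))

theorem IsRowEnd.col_lt_maxLen {g : Node d} (h : IsRowEnd l g) : g.2.1 + 1 ≤ maxLen l := by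
  rw [h]
  exact rowLen_le_maxLen _ _ _

theorem isRowEnd_of_maxLen {g : Node d} (hg : g ∈ diagram l) (h : g.2.1 + 1 = maxLen l) :
    IsRowEnd l g := by
  obtain ⟨a, b, c⟩ := g
  rw [mem_diagram_iff_lt_rowLen] at hg
  have := rowLen_le_maxLen l a c
  rw [IsRowEnd]
  dsimp only at *
  omega

/-- Excludes `e = 1`: there `k - 1 = k`, and the node given by `hk` would violate `hk'`. -/
theorem one_ne_zero_of_step (hk : ∃ x : Node d, IsRemovable l x ∧ x.2.1 + 1 = maxLen l ∧
      residue e v x = k)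
    (hk' : ∀ g : Node d, IsRowEnd l g → g.2.1 + 1 = maxLen l → residue e v g ≠ k - 1) :
    (1 : ZMod e) ≠ 0 := by
  obtain ⟨x, hx, hm, hr⟩ := hk
  intro h
  exact hk' x hx.isRowEnd hm (by rw [hr, h, sub_zero])

theorem mem_strip_of_step {x : Node d} (hx : x ∈ diagram l) (hm : x.2.1 + 1 = maxLen l)
    (hr : residue e v x = k)
    (hk' : ∀ g : Node d, IsRowEnd l g → g.2.1 + 1 = maxLen l → residue e v g ≠ k - 1) :
    x ∈ strip e v l k := by
  refine (isRowEnd_of_maxLen hx hm).mem_strip hr fun h hh hhr => ?_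
  have := hh.col_lt_maxLen
  have : h.2.1 + 1 ≠ maxLen l := fun h' => hk' h hh h' hhr
  omega

theorem exists_diagram_eq_sdiff_strip (e : ℕ) (v : Fin d → ℕ) (k : ZMod e)
    (l : Multipartition d) : ∃ l' : Multipartition d, diagram l' = diagram l \ strip e v l k := by
  rw [exists_diagram_eq_iff]
  intro a b c h a' b' ha hb
  rw [Finset.mem_sdiff] at h ⊢
  refine ⟨mem_diagram_mono h.1 ha hb, fun h' => ?_⟩
  have hrem := isRemovable_iff.1 (mem_strip.1 h').1
  rcases ha.eq_or_lt with rfl | hlt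
  · rcases hb.eq_or_lt with rfl | hlt
    · exact h.2 h'
    · exact hrem.2.2 (mem_diagram_mono h.1 le_rfl hlt)
  · exact hrem.2.1 (mem_diagram_mono h.1 hlt hb)

theorem mem_sdiff_strip (hl' : diagram l' = diagram l \ strip e v l k) {g : Node d} :
    g ∈ diagram l' ↔ g ∈ diagram l ∧ g ∉ strip e v l k := by
  rw [hl', Finset.mem_sdiff]

theorem diagram_eq_union_strip (hl' : diagram l' = diagram l \ strip e v l k) :
    diagram l = diagram l' ∪ strip e v l k := by
  rw [hl', Finset.sdiff_union_of_subset strip_subset]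

theorem disjoint_strip (hl' : diagram l' = diagram l \ strip e v l k) :
    Disjoint (diagram l') (strip e v l k) := by
  rw [hl']
  exact Finset.sdiff_disjoint

theorem rank_eq_add_strip (hl' : diagram l' = diagram l \ strip e v l k) :
    rank l = rank l' + (strip e v l k).card := by
  rw [← card_diagram, diagram_eq_union_strip hl',
    Finset.card_union_of_disjoint (disjoint_strip hl'), card_diagram]

/-- Transports the FLOTW inequalities. A strict inequality survives the loss of one node; rows of
equal length have ends of the same residue and column, so both ends lie in the strip or neither
does. -/
theorem rowLen_le_of_strip (hl' : diagram l' = diagram l \ strip e v l k) {a₁ a₂ : ℕ}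
    {c₁ c₂ : Fin d} (hr : ∀ b, residue e v (a₁, b, c₁) = residue e v (a₂, b, c₂))
    (h : (l c₂).rowLen a₂ ≤ (l c₁).rowLen a₁) : (l' c₂).rowLen a₂ ≤ (l' c₁).rowLen a₁ := by
  refine le_of_forall_lt fun b hb => ?_
  rw [← mem_diagram_iff_lt_rowLen, mem_sdiff_strip hl'] at hb ⊢
  obtain ⟨hb, hbs⟩ := hb
  refine ⟨mem_diagram_iff_lt_rowLen.2 ((mem_diagram_iff_lt_rowLen.1 hb).trans_le h), fun hs => ?_⟩
  obtain ⟨hrem, hk, hlt⟩ := mem_strip.1 hs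
  have hend : IsRowEnd l (a₂, b, c₂) := by
    have h1 := hrem.isRowEnd
    have h2 := mem_diagram_iff_lt_rowLen.1 hb
    rw [IsRowEnd] at h1 ⊢
    dsimp only at *
    omega
  exact hbs (hend.mem_strip (by rw [← hr, hk]) hlt)

theorem isRowEnd_sdiff_strip (hl' : diagram l' = diagram l \ strip e v l k) {a b : ℕ} {c : Fin d}
    (h : IsRowEnd l' (a, b, c)) : (IsRowEnd l (a, b, c) ∧ (a, b, c) ∉ strip e v l k) ∨
      (a, b + 1, c) ∈ strip e v l k := by
  rw [isRowEnd_iff, mem_sdiff_strip hl', mem_sdiff_strip hl'] at h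
  rw [isRowEnd_iff]
  tauto

theorem IsFLOTW.sdiff_strip (hlt : ∀ j, v j < e) (hmono : Monotone v) (h1 : (1 : ZMod e) ≠ 0)
    (hl : IsFLOTW e v l) (hl' : diagram l' = diagram l \ strip e v l k) : IsFLOTW e v l' where
  next j j' hj i := by
    refine rowLen_le_of_strip hl' (fun b => ?_) (hl.next j j' hj i)
    have hv : v j ≤ v j' := hmono (Fin.le_def.2 (by omega))
    simp only [residue, content]
    push_cast [Nat.cast_sub hv]
    ring
  wrap j j' hj hj' i := by
    refine rowLen_le_of_strip hl' (fun b => ?_) (hl.wrap j j' hj hj' i)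
    have hv : v j' ≤ e + v j := by
      have := hlt j'
      omega
    simp only [residue, content]
    push_cast [Nat.cast_sub hv]
    rw [ZMod.natCast_self]
    ring
  missing b hb := by
    obtain ⟨r, hr⟩ := hl.missing b hb
    by_cases hA : ∃ y ∈ strip e v l k, y.2.1 = b
    · obtain ⟨y, hy, rfl⟩ := hA
      by_cases hB : ∃ h : Node d, IsRowEnd l h ∧ residue e v h = k - 1 ∧ h.2.1 + 1 = y.2.1
      · obtain ⟨h, hend, hres, hcol⟩ := hB
        refine ⟨r, ?_⟩
        rintro ⟨a, b, c⟩ hg hgcol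
        rcases isRowEnd_sdiff_strip hl' hg with hg' | hg'
        · exact hr _ hg'.1 hgcol
        · have := (mem_strip.1 hg').2.1
          rw [residue_succ_col] at this
          rw [eq_sub_of_add_eq this, ← hres]
          exact hr h hend hcol
      · refine ⟨k, ?_⟩
        rintro ⟨a, b, c⟩ hg hgcol hgk
        rcases isRowEnd_sdiff_strip hl' hg with hg' | hg'
        · refine hg'.2 (hg'.1.mem_strip hgk fun h hh hhr => ?_)
          have h2 := (mem_strip.1 hy).2.2 h hh hhr
          have h3 : h.2.1 + 1 ≠ y.2.1 := fun h' => hB ⟨h, hh, hhr, h'⟩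
          dsimp only at *
          omega
        · have := (mem_strip.1 hg').2.1
          rw [residue_succ_col, hgk] at this
          exact h1 (by linear_combination this)
    · refine ⟨r, ?_⟩
      rintro ⟨a, b', c⟩ hg hgcol
      rcases isRowEnd_sdiff_strip hl' hg with hg' | hg'
      · exact hr _ hg'.1 hgcol
      · exact absurd ⟨_, hg', hgcol⟩ hA

/-- Two successive steps of an `a`-sequence have different residues. -/
theorem residue_ne_of_steps
    (hk : ∃ x : Node d, IsRemovable l x ∧ x.2.1 + 1 = maxLen l ∧ residue e v x = k)
    (hk' : ∀ g : Node d, IsRowEnd l g → g.2.1 + 1 = maxLen l → residue e v g ≠ k - 1)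
    (hl' : diagram l' = diagram l \ strip e v l k)
    (hk₂ : ∃ x : Node d, IsRemovable l' x ∧ x.2.1 + 1 = maxLen l' ∧ residue e v x = k)
    (hk₂' : ∀ g : Node d, IsRowEnd l' g → g.2.1 + 1 = maxLen l' → residue e v g ≠ k - 1) :
    False := by
  have h1 := one_ne_zero_of_step hk hk'
  obtain ⟨x', hx', hm', hr'⟩ := hk₂
  have hx'l := (mem_sdiff_strip hl').1 hx'.1
  by_cases hmax : x'.2.1 + 1 = maxLen l
  · exact hx'l.2 (mem_strip_of_step hx'l.1 hmax hr' hk')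
  -- All parts of maximal length must have been shortened. The row of the node from `hk` then has
  -- maximal length in `l'` and ends in residue `k - 1`.
  · obtain ⟨⟨a, b, c⟩, hx, hm, hr⟩ := hk
    have hle : x'.2.1 + 1 ≤ maxLen l :=
      (Nat.succ_le_of_lt (mem_diagram_iff_lt_rowLen.1 hx'l.1)).trans (rowLen_le_maxLen _ _ _)
    dsimp only at hm
    obtain ⟨b, rfl⟩ : ∃ b', b = b' + 1 := ⟨b - 1, by omega⟩
    have hrb : residue e v (a, b, c) = k - 1 := by
      rw [residue_succ_col] at hr
      rw [← hr, add_sub_cancel_right]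
    have hmem : (a, b, c) ∈ diagram l' := by
      rw [mem_sdiff_strip hl']
      refine ⟨mem_diagram_mono hx.1 le_rfl (by omega), fun h => h1 ?_⟩
      have := (mem_strip.1 h).2.1
      rw [hrb] at this
      linear_combination -this
    have hlen := rowLen_le_maxLen l' a c
    have hlen' := mem_diagram_iff_lt_rowLen.1 hmem
    exact hk₂' (a, b, c) (isRowEnd_of_maxLen hmem (by dsimp only; omega))
      (by dsimp only; omega) hrb

end Strip

/-! Existence of `a`-sequences -/

/-- Otherwise `R` is stable under subtracting `1`, which runs through all of `ZMod e`. -/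
theorem exists_residue_of_ne_univ {e : ℕ} (he : 0 < e) {R : Set (ZMod e)} (hne : R.Nonempty)
    {r : ZMod e} (hr : r ∉ R) : ∃ k ∈ R, k - 1 ∉ R := by
  by_contra! h
  obtain ⟨k, hk⟩ := hne
  have key : ∀ n : ℕ, k - n ∈ R := by
    intro n
    induction n with
    | zero => simpa using hk
    | succ n ih =>
      have := h _ ih
      rwa [sub_sub, ← Nat.cast_succ] at this
  have : NeZero e := ⟨he.ne'⟩
  have := key (k - r).val
  rw [ZMod.natCast_zmod_val, sub_sub_cancel] at this
  exact hr this

theorem exists_isASequence (hd : 0 < d) {e : ℕ} {v : Fin d → ℕ} (hmono : Monotone v)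
    (hlt : ∀ j, v j < e) (l : Multipartition d) (hl : IsFLOTW e v l) :
    ∃ S : List (ZMod e), IsASequence e v l S := by
  induction hn : rank l using Nat.strong_induction_on generalizing l with
  | _ n ih =>
  subst hn
  have he : 0 < e := (Nat.zero_le _).trans_lt (hlt ⟨0, hd⟩)
  by_cases hempty : diagram l = ∅
  · have : l = emptyMP d := by
      apply diagram_injective
      rw [hempty]
      ext ⟨a, b, c⟩
      simp [mem_diagram, emptyMP]
    subst this
    exact ⟨[], .empty⟩
  · obtain ⟨⟨a, b, c⟩, hg⟩ := Finset.nonempty_iff_ne_empty.2 hempty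
    have hpos : 0 < maxLen l :=
      (Nat.zero_le _).trans_lt ((mem_diagram_iff_lt_rowLen.1 hg).trans_le (rowLen_le_maxLen _ _ _))
    obtain ⟨r, hr⟩ := hl.missing _ hpos
    obtain ⟨c₀, -, hc₀⟩ := Finset.exists_mem_eq_sup Finset.univ ⟨⟨0, hd⟩, Finset.mem_univ _⟩
      fun c => (l c).rowLen 0
    obtain ⟨k, ⟨x, hx, hxm, hxk⟩, hk'⟩ := exists_residue_of_ne_univ he
      (R := {k | ∃ g : Node d, IsRowEnd l g ∧ g.2.1 + 1 = maxLen l ∧ residue e v g = k})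
      (r := r) ⟨_, (0, maxLen l - 1, c₀), by
        change maxLen l = _ at hc₀
        rw [IsRowEnd]
        dsimp only
        omega, by dsimp only; omega, rfl⟩
      (by
        rintro ⟨g, h1, h2, h3⟩
        exact hr g h1 h2 h3)
    have hk'' : ∀ g : Node d, IsRowEnd l g → g.2.1 + 1 = maxLen l → residue e v g ≠ k - 1 :=
      fun g h1 h2 h3 => hk' ⟨g, h1, h2, h3⟩
    -- So far `x` is only a row end; its membership in the strip makes it removable.
    have hxl : x ∈ diagram l := by
      obtain ⟨a, b, c⟩ := x
      exact (isRowEnd_iff.1 hx).1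
    have hxs := mem_strip_of_step hxl hxm hxk hk''
    have hkk : ∃ x : Node d, IsRemovable l x ∧ x.2.1 + 1 = maxLen l ∧ residue e v x = k :=
      ⟨x, (mem_strip.1 hxs).1, hxm, hxk⟩
    obtain ⟨l', hl'⟩ := exists_diagram_eq_sdiff_strip e v k l
    have hcard : 0 < (strip e v l k).card := Finset.card_pos.2 ⟨x, hxs⟩
    have hrank := rank_eq_add_strip hl'
    obtain ⟨S, hS⟩ := ih (rank l') (by omega) l'
      (hl.sdiff_strip hlt hmono (one_ne_zero_of_step hkk hk'') hl') rfl
    exact ⟨_, .step l l' k S hkk hk'' hl' hS⟩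

/-! Counting nodes of a given residue to the right of a given column -/

open Classical in
/-- The number of nodes of residue `k` in the columns `≥ t`. -/
noncomputable def colCount (e : ℕ) (v : Fin d → ℕ) (m : Multipartition d) (k : ZMod e) (t : ℕ) :
    ℕ := ((diagram m).filter fun g => residue e v g = k ∧ t ≤ g.2.1).card

section ColCount

variable {e : ℕ} {v : Fin d → ℕ} {k : ZMod e} {l l' m m' : Multipartition d}
  {A : Finset (Node d)}

/-- Moving one column to the left is injective on nodes and lowers the residue by one. The converse
inequality `le_colCount_succ` holds once no row end of residue `k - 1` lies in columns `≥ t`. -/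
theorem colCount_succ_le (m : Multipartition d) (k : ZMod e) (t : ℕ) :
    colCount e v m k (t + 1) ≤ colCount e v m (k - 1) t := by
  classical
  refine Finset.card_le_card_of_injOn (fun g => (g.1, g.2.1 - 1, g.2.2)) ?_ ?_
  · rintro ⟨a, b, c⟩ h
    simp only [Finset.coe_filter, Set.mem_ofPred_eq] at h ⊢
    obtain ⟨b, rfl⟩ : ∃ b', b = b' + 1 := ⟨b - 1, by omega⟩
    rw [residue_succ_col] at h
    rw [Nat.add_sub_cancel]
    exact ⟨mem_diagram_mono h.1 le_rfl (by omega), eq_sub_of_add_eq h.2.1, by omega⟩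
  · rintro ⟨a, b, c⟩ h ⟨a', b', c'⟩ h' hh
    simp only [Finset.coe_filter, Set.mem_ofPred_eq, Prod.mk.injEq] at h h' hh ⊢
    exact ⟨hh.1, by omega, hh.2.2⟩

theorem le_colCount_succ {t : ℕ}
    (h : ∀ g : Node d, IsRowEnd m g → residue e v g = k - 1 → g.2.1 < t) :
    colCount e v m (k - 1) t ≤ colCount e v m k (t + 1) := by
  classical
  refine Finset.card_le_card_of_injOn (fun g => (g.1, g.2.1 + 1, g.2.2)) ?_ ?_
  · rintro ⟨a, b, c⟩ hg
    simp only [Finset.coe_filter, Set.mem_ofPred_eq] at hg ⊢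
    rw [residue_succ_col, hg.2.1, sub_add_cancel]
    refine ⟨?_, rfl, by omega⟩
    by_contra hn
    exact absurd (h _ (isRowEnd_iff.2 ⟨hg.1, hn⟩) hg.2.1) (not_lt.2 hg.2.2)
  · rintro ⟨a, b, c⟩ h ⟨a', b', c'⟩ h' hh
    simp only [Prod.mk.injEq] at hh ⊢
    exact ⟨hh.1, by omega, hh.2.2⟩

open Classical in
theorem colCount_union (hm : diagram m = diagram m' ∪ A) (hdisj : Disjoint (diagram m') A)
    (hA : ∀ g ∈ A, residue e v g = k) (k' : ZMod e) (t : ℕ) :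
    colCount e v m k' t = colCount e v m' k' t +
      if k' = k then (A.filter fun g => t ≤ g.2.1).card else 0 := by
  rw [colCount, hm, Finset.filter_union, Finset.card_union_of_disjoint
    (hdisj.mono (Finset.filter_subset _ _) (Finset.filter_subset _ _)), colCount]
  congr 1
  split_ifs with h
  · subst h
    congr 1
    refine Finset.filter_congr fun g hg => ?_
    simp [hA g hg]
  · rw [Finset.card_eq_zero, Finset.filter_eq_empty_iff]
    rintro g hg ⟨h', -⟩
    exact h (by rw [← h', hA g hg])

/-- Adding nodes of residue `k` anywhere gives at most as many nodes to the right of a given column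
as adding the strip. -/
theorem colCount_addNodes_le (h1 : (1 : ZMod e) ≠ 0)
    (hl' : diagram l' = diagram l \ strip e v l k) (hA : A ⊆ kAddable e v k m')
    (hcard : A.card = (strip e v l k).card)
    (hE : ∀ k' t, colCount e v m' k' t ≤ colCount e v l' k' t) (k' : ZMod e) (t : ℕ) :
    colCount e v (addNodes m' A) k' t ≤ colCount e v l k' t := by
  classical
  have hm := colCount_union (diagram_addNodes hA) (disjoint_of_subset_kAddable hA)
    (fun g hg => residue_of_subset_kAddable hA hg)
  have hl := colCount_union (diagram_eq_union_strip hl') (disjoint_strip hl')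
    (fun g hg => (mem_strip.1 hg).2.1)
  by_cases hk : k' = k
  · subst hk
    by_cases ht : ∀ g ∈ strip e v l k', t ≤ g.2.1
    · rw [hm, hl, if_pos rfl, if_pos rfl, Finset.filter_true_of_mem ht, ← hcard]
      exact add_le_add (hE _ _) (Finset.card_filter_le _ _)
    -- Some strip node lies to the left of column `t`. All `(k-1)`-ends of `l` lie further left
    -- still, so `l` attains the upper bound given by the `(k-1)`-nodes, which the step leaves
    -- unchanged.
    · push Not at ht
      obtain ⟨g, hg, hgt⟩ := ht
      obtain ⟨t, rfl⟩ : ∃ t', t = t' + 1 := ⟨t - 1, by omega⟩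
      have hne : k' - 1 ≠ k' := fun h => h1 (by linear_combination -h)
      calc colCount e v (addNodes m' A) k' (t + 1)
          ≤ colCount e v (addNodes m' A) (k' - 1) t := colCount_succ_le _ _ _
        _ = colCount e v m' (k' - 1) t := by rw [hm, if_neg hne, add_zero]
        _ ≤ colCount e v l' (k' - 1) t := hE _ _
        _ = colCount e v l (k' - 1) t := by rw [hl, if_neg hne, add_zero]
        _ ≤ colCount e v l k' (t + 1) := le_colCount_succ fun h hh hhr =>
            ((mem_strip.1 hg).2.2 h hh hhr).trans_le (by omega)
  · rw [hm, hl, if_neg hk, if_neg hk]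
    exact hE _ _

/-- Compare counts at the leftmost strip column. As `m'` has no more `k`-nodes there than `l'`, all
of `A` must lie in that column or to its right. These nodes are removable in `l`, hence belong to
the strip, and the cardinalities agree. -/
theorem addNodes_eq_imp_eq_strip (h1 : (1 : ZMod e) ≠ 0)
    (hl' : diagram l' = diagram l \ strip e v l k) (hA : A ⊆ kAddable e v k m')
    (hcard : A.card = (strip e v l k).card)
    (hE : ∀ k' t, colCount e v m' k' t ≤ colCount e v l' k' t) (heq : addNodes m' A = l) :
    A = strip e v l k := by
  classical
  rcases (strip e v l k).eq_empty_or_nonempty with hs | hs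
  · rw [hs, Finset.card_empty, Finset.card_eq_zero] at hcard
    rw [hcard, hs]
  · obtain ⟨g, hg, hmin⟩ := Finset.exists_min_image _ (fun g => g.2.1) hs
    have hm := colCount_union (diagram_addNodes hA) (disjoint_of_subset_kAddable hA)
      (fun g hg => residue_of_subset_kAddable hA hg) k g.2.1
    have hl := colCount_union (diagram_eq_union_strip hl') (disjoint_strip hl')
      (fun g hg => (mem_strip.1 hg).2.1) k g.2.1
    rw [if_pos rfl] at hm hl
    rw [Finset.filter_true_of_mem hmin] at hl
    rw [heq] at hm
    have hle := hE k g.2.1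
    have hfull : A.filter (fun x => g.2.1 ≤ x.2.1) = A :=
      Finset.eq_of_subset_of_card_le (Finset.filter_subset _ _) (by omega)
    refine Finset.eq_of_subset_of_card_le (fun x hx => ?_) hcard.ge
    have hxr : x ∈ kRemovable e v k l := by
      rw [← heq, kRemovable_addNodes h1 hA]
      exact Finset.mem_union_right _ hx
    rw [mem_kRemovable] at hxr
    refine mem_strip.2 ⟨hxr.1, hxr.2, fun h hh hhr => ?_⟩
    rw [← hfull, Finset.mem_filter] at hx
    exact ((mem_strip.1 hg).2.2 h hh hhr).trans_le hx.2

theorem strip_subset_kAddable (hl' : diagram l' = diagram l \ strip e v l k) :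
    strip e v l k ⊆ kAddable e v k l' := by
  intro g hg
  refine mem_kAddable.2 ⟨⟨fun h => ((mem_sdiff_strip hl').1 h).2 hg, ?_⟩, (mem_strip.1 hg).2.1⟩
  rw [exists_diagram_eq_iff]
  intro a b c h a' b' ha hb
  classical
  have hmem : (a', b', c) ∈ diagram l := by
    refine mem_diagram_mono ?_ ha hb
    rcases Finset.mem_insert.1 h with h | h
    · rw [h]
      exact strip_subset hg
    · exact ((mem_sdiff_strip hl').1 h).1
  rw [Finset.mem_insert, mem_sdiff_strip hl']
  by_contra! hn
  have hs := hn.2 hmem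
  have hrem := isRemovable_iff.1 (mem_strip.1 hs).1
  have hmem' : (a, b, c) ∈ diagram l := by
    rcases Finset.mem_insert.1 h with h | h
    · rw [h]
      exact strip_subset hg
    · exact ((mem_sdiff_strip hl').1 h).1
  rcases ha.eq_or_lt with rfl | hlt
  · rcases hb.eq_or_lt with rfl | hlt
    · rcases Finset.mem_insert.1 h with h | h
      · exact hn.1 h
      · exact ((mem_sdiff_strip hl').1 h).2 hs
    · exact hrem.2.2 (mem_diagram_mono hmem' le_rfl hlt)
  · exact hrem.2.1 (mem_diagram_mono hmem' hlt hb)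

theorem addNodes_strip (hl' : diagram l' = diagram l \ strip e v l k) :
    addNodes l' (strip e v l k) = l := by
  classical
  apply diagram_injective
  rw [diagram_addNodes (strip_subset_kAddable hl'), ← diagram_eq_union_strip hl']

end ColCount

/-! The rows of FLOTW multipartitions -/

section Rows

variable {e : ℕ} {v : Fin d → ℕ} {l : Multipartition d}

theorem IsFLOTW.rowLen_le_of_le (hmono : Monotone v) (hl : IsFLOTW e v l) {c' c : Fin d}
    (hc : c' ≤ c) (i : ℕ) : (l c).rowLen (i + (v c - v c')) ≤ (l c').rowLen i := by
  obtain ⟨n, hn⟩ : ∃ n, (c : ℕ) = c' + n := ⟨c - c', by have := Fin.le_def.1 hc; omega⟩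
  induction n generalizing c with
  | zero =>
    have : c = c' := Fin.ext hn
    subst this
    simp
  | succ n ih =>
    have hlt := c.isLt
    have hcc : c' ≤ (⟨c' + n, by omega⟩ : Fin d) := Fin.le_def.2 (by simp)
    have hcc' : (⟨c' + n, by omega⟩ : Fin d) ≤ c := Fin.le_def.2 (by dsimp only; omega)
    refine le_trans ?_ (ih (c := ⟨c' + n, by omega⟩) hcc rfl)
    have := hl.next ⟨c' + n, by omega⟩ c (by dsimp only; omega)
      (i + (v ⟨c' + n, by omega⟩ - v c'))
    have h1 := hmono hcc
    have h2 := hmono hcc'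
    rwa [show i + (v ⟨c' + n, by omega⟩ - v c') + (v c - v ⟨c' + n, by omega⟩) =
      i + (v c - v c') by omega] at this

/-- Go from `c'` up to the last component, wrap around to the first, and continue up to `c`; the
shifts add up to `e + v c - v c'`. -/
theorem IsFLOTW.rowLen_add_le (hmono : Monotone v) (hlt : ∀ j, v j < e) (hl : IsFLOTW e v l)
    (c' c : Fin d) (i : ℕ) : (l c).rowLen (i + (e + v c - v c')) ≤ (l c').rowLen i := by
  have hd := c.isLt
  set z : Fin d := ⟨0, by omega⟩ with hz
  set y : Fin d := ⟨d - 1, by omega⟩ with hy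
  have hzc : z ≤ c := Fin.le_def.2 (Nat.zero_le _)
  have hcy : c' ≤ y := Fin.le_def.2 (by have := c'.isLt; simp only [hy]; omega)
  have h1 := hl.rowLen_le_of_le hmono hcy i
  have h2 := hl.wrap z y rfl (by simp only [hy]; omega) (i + (v y - v c'))
  have h3 := hl.rowLen_le_of_le hmono hzc (i + (v y - v c') + (e + v z - v y))
  have := hmono hzc
  have := hmono hcy
  have := hlt y
  rw [show i + (v y - v c') + (e + v z - v y) + (v c - v z) = i + (e + v c - v c') by omega] at h3
  exact h3.trans (h2.trans h1)

/-- The position of a node, refining the FLOTW order on nodes of the same residue. -/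
def position (e : ℕ) (v : Fin d → ℕ) (g : Node d) : ℤ := d * content v g - e * (g.2.2 : ℕ)

theorem exists_content_eq (g g' : Node d) (hr : residue e v g = residue e v g') :
    ∃ z : ℤ, content v g' = content v g + e * z := by
  rw [residue, residue, ZMod.intCast_eq_intCast_iff_dvd_sub] at hr
  obtain ⟨z, hz⟩ := hr
  exact ⟨z, by omega⟩

/-- If the contents differ by `e * z`, the positions differ by `e * (d * z - (c' - c))`, and `|c' -
c| < d`. -/
theorem IsAbove.position_le (he : 0 < e) {g g' : Node d} (h : IsAbove v g g')
    (hr : residue e v g = residue e v g') : position e v g ≤ position e v g' := by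
  have hc := g.2.2.isLt
  have hc' := g'.2.2.isLt
  obtain ⟨z, hz⟩ := exists_content_eq g g' hr
  have he : (0 : ℤ) < e := by exact_mod_cast he
  have hsub : position e v g' - position e v g = e * (d * z - ((g'.2.2 : ℕ) - (g.2.2 : ℕ))) := by
    rw [position, position, hz]
    ring
  rw [← sub_nonneg, hsub]
  apply mul_nonneg he.le
  rcases h with h | ⟨h, h'⟩
  · have hz1 : 0 < z := (mul_pos_iff_of_pos_left he).1 (by omega)
    have : (d : ℤ) * 1 ≤ d * z := mul_le_mul_of_nonneg_left hz1 (by positivity)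
    omega
  · rw [Fin.lt_def] at h'
    have hz0 : z = 0 := (mul_eq_zero.1 (show (e : ℤ) * z = 0 by omega)).resolve_left he.ne'
    subst hz0
    omega

/-- With contents differing by `e * z`, the position inequality leaves either `z = 0` and `c' ≤ c`,
or `z ≥ 1`. These cases are covered by `rowLen_le_of_le` and `rowLen_add_le` respectively. -/
theorem IsFLOTW.mem_of_position_le (hmono : Monotone v) (hlt : ∀ j, v j < e)
    (hl : IsFLOTW e v l) {g g' : Node d} (hg : g ∈ diagram l)
    (hr : residue e v g = residue e v g') (hcol : g'.2.1 ≤ g.2.1)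
    (hp : position e v g ≤ position e v g') : g' ∈ diagram l := by
  obtain ⟨z, hz⟩ := exists_content_eq g g' hr
  obtain ⟨a, b, c⟩ := g
  obtain ⟨a', b', c'⟩ := g'
  have he : (0 : ℤ) < e := by exact_mod_cast (Nat.zero_le _).trans_lt (hlt c)
  have hsub : position e v (a', b', c') - position e v (a, b, c) =
      e * (d * z - ((c' : ℕ) - (c : ℕ))) := by
    rw [position, position, hz]
    ring
  rw [← sub_nonneg, hsub] at hp
  have hp := nonneg_of_mul_nonneg_right hp he
  have h1 := c.isLt
  have h2 := c'.isLt
  have h3 := hlt c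
  have h4 := hlt c'
  have hz0 : 0 ≤ z := by
    by_contra! hz0
    have : (d : ℤ) * z ≤ d * (-1) := mul_le_mul_of_nonneg_left (by omega) (by positivity)
    omega
  simp only [content] at hz
  dsimp only at hcol
  rw [mem_diagram_iff_lt_rowLen] at hg ⊢
  have hanti : ∀ j, j ≤ a → (l c).rowLen j ≤ (l c').rowLen a' → b' < (l c').rowLen a' :=
    fun j hj hle => hcol.trans_lt (hg.trans_le (((l c).rowLen_anti _ _ hj).trans hle))
  rcases hz0.eq_or_lt with rfl | hz1
  · have hcc : c' ≤ c := Fin.le_def.2 (by omega)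
    have := hmono hcc
    exact hanti _ (by omega) (hl.rowLen_le_of_le hmono hcc a')
  · have : (e : ℤ) * 1 ≤ e * z := mul_le_mul_of_nonneg_left (by omega) he.le
    exact hanti _ (by omega) (hl.rowLen_add_le hmono hlt c' c a')

-- Both counts vanish for each strip node `g`. A removable `k`-node of `l'` below `g` lies to the
-- left of `g`, and then `l` contains its diagonal successor, which has the same residue and
-- position. An addable `k`-node of `l` below `g` lies to the right of `g`, so its left neighbour is
-- a `(k-1)`-end that is too long.
open Classical in
theorem IsFLOTW.stripExponent_eq_zero (hmono : Monotone v) (hlt : ∀ j, v j < e)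
    (h1 : (1 : ZMod e) ≠ 0) (hl : IsFLOTW e v l) {l' : Multipartition d} {k : ZMod e}
    (hl' : diagram l' = diagram l \ strip e v l k) :
    stripExponent e v k l' (strip e v l k) = 0 := by
  have hS := strip_subset_kAddable hl'
  have ha := kAddable_addNodes h1 hS
  have hr := kRemovable_addNodes h1 hS
  rw [addNodes_strip hl'] at ha hr
  refine Finset.sum_eq_zero fun g hg => ?_
  obtain ⟨hrem, hk, hend⟩ := mem_strip.1 hg
  rw [← ha, Finset.filter_false_of_mem, Finset.filter_false_of_mem, Finset.card_empty, sub_self]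
  · rintro ⟨a, b, c⟩ hx habove
    have hx' : (a, b, c) ∈ kRemovable e v k l := hr ▸ Finset.mem_union_left _ hx
    obtain ⟨hxrem, hxk⟩ := mem_kRemovable.1 hx'
    have hxs : (a, b, c) ∉ strip e v l k := fun h => by
      exact ((mem_sdiff_strip hl').1 (mem_kRemovable.1 hx).1.1).2 h
    have hcol : b < g.2.1 := by
      by_contra! hb
      exact hxs (mem_strip.2 ⟨hxrem, hxk, fun h hh hhr => (hend h hh hhr).trans_le hb⟩)
    have hpos := habove.position_le ((Nat.zero_le _).trans_lt (hlt c)) (hk.trans hxk.symm)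
    have hmem : (a + 1, b + 1, c) ∈ diagram l := by
      refine hl.mem_of_position_le hmono hlt hrem.1 ?_ hcol ?_
      · rw [residue_succ_col, residue_succ_row, hxk, hk, sub_add_cancel]
      · refine hpos.trans_eq ?_
        simp only [position, content]
        push_cast
        ring
    exact (isRemovable_iff.1 hxrem).2.1 (mem_diagram_mono hmem le_rfl (by omega))
  · rintro ⟨a, b, c⟩ hx habove
    obtain ⟨hxadd, hxk⟩ := mem_kAddable.1 hx
    have hpos := habove.position_le ((Nat.zero_le _).trans_lt (hlt c)) (hk.trans hxk.symm)
    have hcol : g.2.1 < b := by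
      by_contra! hb
      exact hxadd.1 (hl.mem_of_position_le hmono hlt hrem.1 (hk.trans hxk.symm) hb hpos)
    obtain ⟨b, rfl⟩ : ∃ b', b = b' + 1 := ⟨b - 1, by omega⟩
    rw [isAddable_iff] at hxadd
    rw [residue_succ_col] at hxk
    have := hend (a, b, c) (isRowEnd_iff.2 ⟨hxadd.2.2 b rfl, hxadd.1⟩) (eq_sub_of_add_eq hxk)
    dsimp only at this
    omega

end Rows

/-! Counting nodes of a given residue below a given position -/

open Classical in
/-- The number of nodes of residue `k` with position at least `T`. -/
noncomputable def resPosCount (e : ℕ) (v : Fin d → ℕ) (m : Multipartition d) (k : ZMod e) (T : ℤ) :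
    ℕ := ((diagram m).filter fun g => residue e v g = k ∧ T ≤ position e v g).card

/-- The number of nodes with position at least `T`. -/
def posCount (e : ℕ) (v : Fin d → ℕ) (m : Multipartition d) (T : ℤ) : ℕ :=
  ((diagram m).filter fun g => T ≤ position e v g).card

section PosCount

variable {e : ℕ} {v : Fin d → ℕ} {l m : Multipartition d}

/-- The column `t` is one past the rightmost `k`-node of `l` with position `< T`. That node has
position `≤ T - 1`, whence the bound `T - 1` in the second claim, needed for the equality case. -/
theorem IsFLOTW.exists_column (hmono : Monotone v) (hlt : ∀ j, v j < e) (hl : IsFLOTW e v l)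
    (k : ZMod e) (T : ℤ) :
    ∃ t : ℕ, (∀ g ∈ diagram l, residue e v g = k → t ≤ g.2.1 → T ≤ position e v g) ∧
      ∀ g : Node d, residue e v g = k → g.2.1 < t → T - 1 ≤ position e v g → g ∈ diagram l := by
  classical
  refine ⟨((diagram l).filter fun g => residue e v g = k ∧ position e v g < T).sup
    fun g => g.2.1 + 1, fun g hg hk ht => ?_, fun g hk ht hT => ?_⟩
  · by_contra! hT
    have hmem : g ∈ (diagram l).filter fun g => residue e v g = k ∧ position e v g < T :=
      Finset.mem_filter.2 ⟨hg, hk, hT⟩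
    have := Finset.le_sup (f := fun g : Node d => g.2.1 + 1) hmem
    omega
  · rw [Finset.lt_sup_iff] at ht
    obtain ⟨x, hx, hcol⟩ := ht
    obtain ⟨hx, hxk, hxT⟩ := Finset.mem_filter.1 hx
    exact hl.mem_of_position_le hmono hlt hx (hxk.trans hk.symm) (by omega) (by omega)

-- Split at column `t`. To its left, `l` contains every candidate node; from `t` on, all `k`-nodes
-- of `l` have position `≥ T`, so `colCount` gives the bound. The extra term is the slack, which
-- must vanish in case of equality.
open Classical in
theorem IsFLOTW.resPosCount_add_le (hmono : Monotone v) (hlt : ∀ j, v j < e)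
    (hl : IsFLOTW e v l) (hE : ∀ k t, colCount e v m k t ≤ colCount e v l k t) (k : ZMod e)
    (T : ℤ) : ∃ t : ℕ,
      (∀ g : Node d, residue e v g = k → g.2.1 < t → T - 1 ≤ position e v g → g ∈ diagram l) ∧
      resPosCount e v m k T + ((diagram m).filter fun g =>
        (residue e v g = k ∧ t ≤ g.2.1) ∧ ¬ T ≤ position e v g).card ≤ resPosCount e v l k T := by
  obtain ⟨t, ht, ht'⟩ := hl.exists_column hmono hlt k T
  refine ⟨t, ht', ?_⟩
  have split : ∀ x : Multipartition d, resPosCount e v x k T =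
      ((diagram x).filter fun g => (residue e v g = k ∧ t ≤ g.2.1) ∧ T ≤ position e v g).card +
      ((diagram x).filter fun g => (residue e v g = k ∧ T ≤ position e v g) ∧
        ¬ t ≤ g.2.1).card := by
    intro x
    rw [resPosCount, ← Finset.card_filter_add_card_filter_not (fun g : Node d => t ≤ g.2.1),
      Finset.filter_filter, Finset.filter_filter]
    congr 2
    refine Finset.filter_congr fun g _ => ?_
    tauto
  have hm : colCount e v m k t =
      ((diagram m).filter fun g => (residue e v g = k ∧ t ≤ g.2.1) ∧ T ≤ position e v g).card +
      ((diagram m).filter fun g => (residue e v g = k ∧ t ≤ g.2.1) ∧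
        ¬ T ≤ position e v g).card := by
    rw [colCount, ← Finset.card_filter_add_card_filter_not (fun g : Node d => T ≤ position e v g),
      Finset.filter_filter, Finset.filter_filter]
  have hl' : colCount e v l k t =
      ((diagram l).filter fun g => (residue e v g = k ∧ t ≤ g.2.1) ∧
        T ≤ position e v g).card := by
    rw [colCount]
    congr 1
    refine Finset.filter_congr fun g hg => ?_
    exact ⟨fun h => ⟨h, ht g hg h.1 h.2⟩, fun h => h.1⟩
  have hsub : ((diagram m).filter fun g => (residue e v g = k ∧ T ≤ position e v g) ∧
      ¬ t ≤ g.2.1).card ≤ ((diagram l).filter fun g => (residue e v g = k ∧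
        T ≤ position e v g) ∧ ¬ t ≤ g.2.1).card := by
    refine Finset.card_le_card fun g hg => ?_
    rw [Finset.mem_filter] at hg ⊢
    exact ⟨ht' g hg.2.1.1 (not_le.1 hg.2.2) (by omega), hg.2⟩
  have := hE k t
  rw [split m, split l]
  omega

theorem IsFLOTW.resPosCount_le (hmono : Monotone v) (hlt : ∀ j, v j < e)
    (hl : IsFLOTW e v l) (hE : ∀ k t, colCount e v m k t ≤ colCount e v l k t) (k : ZMod e)
    (T : ℤ) : resPosCount e v m k T ≤ resPosCount e v l k T := by
  obtain ⟨t, -, h⟩ := hl.resPosCount_add_le hmono hlt hE k T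
  omega

theorem IsFLOTW.eq_of_resPosCount_eq (hmono : Monotone v) (hlt : ∀ j, v j < e)
    (hl : IsFLOTW e v l) (hE : ∀ k t, colCount e v m k t ≤ colCount e v l k t)
    (hrank : rank m = rank l) (h : ∀ k T, resPosCount e v m k T = resPosCount e v l k T) :
    m = l := by
  classical
  apply diagram_injective
  refine Finset.eq_of_subset_of_card_le (fun g hg => ?_) (by
    rw [card_diagram, card_diagram, hrank])
  -- With this `T`, the node `g` itself would contribute to the slack if it lay in a column `≥ t`;
  -- otherwise it lies in `l`.
  obtain ⟨t, ht, hle⟩ := hl.resPosCount_add_le hmono hlt hE (residue e v g) (position e v g + 1)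
  rw [h, add_le_iff_nonpos_right, Nat.le_zero, Finset.card_eq_zero,
    Finset.filter_eq_empty_iff] at hle
  refine ht g rfl ?_ (by omega)
  by_contra! hcol
  exact hle hg ⟨⟨rfl, hcol⟩, by omega⟩

theorem posCount_eq_sum [NeZero e] (T : ℤ) :
    posCount e v m T = ∑ k : ZMod e, resPosCount e v m k T := by
  classical
  rw [posCount, Finset.card_eq_sum_card_fiberwise (f := residue e v) (t := Finset.univ)
    (fun _ _ => Finset.mem_coe.2 (Finset.mem_univ _))]
  refine Finset.sum_congr rfl fun k _ => ?_
  rw [resPosCount, Finset.filter_filter]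
  congr 1
  refine Finset.filter_congr fun g _ => ?_
  tauto

theorem IsFLOTW.posCount_le [NeZero e] (hmono : Monotone v) (hlt : ∀ j, v j < e)
    (hl : IsFLOTW e v l) (hE : ∀ k t, colCount e v m k t ≤ colCount e v l k t) (T : ℤ) :
    posCount e v m T ≤ posCount e v l T := by
  rw [posCount_eq_sum, posCount_eq_sum]
  exact Finset.sum_le_sum fun k _ => hl.resPosCount_le hmono hlt hE k T

theorem IsFLOTW.eq_of_posCount_eq [NeZero e] (hmono : Monotone v) (hlt : ∀ j, v j < e)
    (hl : IsFLOTW e v l) (hE : ∀ k t, colCount e v m k t ≤ colCount e v l k t)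
    (hrank : rank m = rank l) (h : ∀ T, posCount e v m T = posCount e v l T) : m = l := by
  refine hl.eq_of_resPosCount_eq hmono hlt hE hrank fun k T => ?_
  have := h T
  rw [posCount_eq_sum, posCount_eq_sum, Finset.sum_eq_sum_iff_of_le
    fun k _ => hl.resPosCount_le hmono hlt hE k T] at this
  exact this k (Finset.mem_univ _)

/-- A monotone weight is larger on the family that has more elements above each bound. -/
theorem sum_le_sum_of_card_le {α : Type*} {s t : Finset α} (p : α → ℤ)
    (hcard : s.card = t.card)
    (h : ∀ T, (s.filter fun x => T ≤ p x).card ≤ (t.filter fun x => T ≤ p x).card)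
    {φ : ℤ → ℚ} (hφ : Monotone φ) : ∑ x ∈ s, φ (p x) ≤ ∑ x ∈ t, φ (p x) := by
  classical
  obtain ⟨lo, hlo⟩ := ((s ∪ t).image p).bddBelow
  obtain ⟨hi, hhi⟩ := ((s ∪ t).image p).bddAbove
  have hlo' : ∀ x ∈ s ∪ t, lo ≤ p x := fun x hx => hlo (Finset.mem_image_of_mem p hx)
  have hhi' : ∀ x ∈ s ∪ t, p x ≤ hi := fun x hx => hhi (Finset.mem_image_of_mem p hx)
  -- Writing `φ` as a sum of nonnegative increments reduces the claim to step functions.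
  have key : ∀ x ∈ s ∪ t, φ (p x) = φ lo + ∑ u ∈ Finset.range (hi - lo).toNat,
      if lo + (u + 1 : ℕ) ≤ p x then φ (lo + (u + 1 : ℕ)) - φ (lo + u) else 0 := by
    intro x hx
    have h1 := hlo' x hx
    have h2 := hhi' x hx
    rw [← Finset.sum_filter, show (Finset.range (hi - lo).toNat).filter
      (fun u : ℕ => lo + (u + 1 : ℕ) ≤ p x) = Finset.range (p x - lo).toNat by
        ext u
        simp only [Finset.mem_filter, Finset.mem_range]
        omega, Finset.sum_range_sub (fun u : ℕ => φ (lo + u)), Int.toNat_of_nonneg (by omega)]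
    simp
  have key' : ∀ r, r ⊆ s ∪ t → ∑ x ∈ r, φ (p x) = r.card * φ lo +
      ∑ u ∈ Finset.range (hi - lo).toNat,
        ((r.filter fun x => lo + (u + 1 : ℕ) ≤ p x).card : ℚ) *
          (φ (lo + (u + 1 : ℕ)) - φ (lo + u)) := by
    intro r hr
    rw [Finset.sum_congr rfl fun x hx => key x (hr hx), Finset.sum_add_distrib,
      Finset.sum_const, nsmul_eq_mul, Finset.sum_comm]
    congr 1
    refine Finset.sum_congr rfl fun u _ => ?_
    rw [← Finset.sum_filter, Finset.sum_const, nsmul_eq_mul]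
  rw [key' s Finset.subset_union_left, key' t Finset.subset_union_right, hcard]
  refine add_le_add le_rfl (Finset.sum_le_sum fun u _ => ?_)
  refine mul_le_mul_of_nonneg_right (by exact_mod_cast h _) (sub_nonneg.2 (hφ ?_))
  push_cast
  omega

/-- Summation by parts for a decreasing weight. -/
theorem sum_mul_sub_shift_nonneg {D Γ : ℤ → ℤ} {d N : ℕ} (hD : ∀ T, D T ≤ 0)
    (hlow : ∀ T ≤ (d : ℤ), D T = 0) (hhigh : ∀ T, (N : ℤ) < T → D T = 0) (hΓ : Antitone Γ) :
    0 ≤ ∑ T ∈ Finset.Icc (1 : ℤ) N, Γ T * (D T - D (T + d)) := by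
  simp only [mul_sub, Finset.sum_sub_distrib]
  -- As `D` vanishes for `T ≤ d` and `T > N`, the range can be shifted by `d`. The summand becomes
  -- `(Γ T - Γ (T - d)) * D T`, a product of nonpositive factors.
  have h1 : ∑ T ∈ Finset.Icc (1 : ℤ) N, Γ T * D T =
      ∑ T ∈ Finset.Icc (1 + d : ℤ) (N + d), Γ T * D T := by
    rw [Finset.sum_subset (s₂ := Finset.Icc (1 : ℤ) (N + d)),
      Finset.sum_subset (s₁ := Finset.Icc (1 + d : ℤ) (N + d)) (s₂ := Finset.Icc (1 : ℤ) (N + d))]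
    · exact Finset.Icc_subset_Icc (by omega) le_rfl
    · intro T hT hT'
      rw [Finset.mem_Icc] at hT hT'
      rw [hlow T (by omega), mul_zero]
    · exact Finset.Icc_subset_Icc le_rfl (by omega)
    · intro T hT hT'
      rw [Finset.mem_Icc] at hT hT'
      rw [hhigh T (by omega), mul_zero]
  have h2 : ∑ T ∈ Finset.Icc (1 : ℤ) N, Γ T * D (T + d) =
      ∑ T ∈ Finset.Icc (1 + d : ℤ) (N + d), Γ (T - d) * D T := by
    refine Finset.sum_bij' (fun T _ => T + d) (fun T _ => T - d) ?_ ?_ ?_ ?_ ?_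
    · intro T hT
      rw [Finset.mem_Icc] at hT ⊢
      omega
    · intro T hT
      rw [Finset.mem_Icc] at hT ⊢
      omega
    · intro T _
      simp
    · intro T _
      simp
    · intro T _
      simp
  rw [h1, h2, ← Finset.sum_sub_distrib]
  refine Finset.sum_nonneg fun T _ => ?_
  rw [← sub_mul]
  exact mul_nonneg_of_nonpos_of_nonpos (sub_nonpos.2 (hΓ (by omega))) (hD T)

theorem sum_Icc_ite_mul_ite {N : ℕ} {x y : ℤ} (hx : 0 ≤ x) (hy : 0 ≤ y) (hxN : x ≤ N) :
    ∑ T ∈ Finset.Icc (1 : ℤ) N, (if T ≤ x then 1 else 0) * (if T ≤ y then 1 else 0 : ℤ) =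
      min x y := by
  have : ∀ T : ℤ, (if T ≤ x then 1 else 0) * (if T ≤ y then 1 else 0 : ℤ) =
      if T ≤ min x y then 1 else 0 := by
    intro T
    simp only [le_min_iff]
    split_ifs <;> simp_all
  simp only [this]
  rw [Finset.sum_boole, show (Finset.Icc (1 : ℤ) N).filter (fun T => T ≤ min x y) =
    Finset.Icc 1 (min x y) by
      ext T
      simp only [Finset.mem_filter, Finset.mem_Icc]
      omega, Int.card_Icc]
  have := le_min hx hy
  omega

end PosCount

/-! The `a`-value in terms of beads -/

theorem row_lt_rank {l : Multipartition d} {g : Node d} (hg : g ∈ diagram l) : g.1 < rank l := by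
  obtain ⟨a, b, c⟩ := g
  have hsub : (Finset.range (a + 1)).image (fun i => (i, b, c)) ⊆ diagram l := by
    intro x hx
    obtain ⟨i, hi, rfl⟩ := Finset.mem_image.1 hx
    exact mem_diagram_mono hg (Nat.lt_succ_iff.1 (Finset.mem_range.1 hi)) le_rfl
  have := Finset.card_le_card hsub
  rw [Finset.card_image_of_injective _ fun i j hij => (Prod.mk.inj hij).1, Finset.card_range,
    card_diagram] at this
  exact this

theorem sum_diagram {M : Type*} [AddCommMonoid M] {l : Multipartition d} {n : ℕ}
    (hn : rank l ≤ n) (φ : Node d → M) :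
    ∑ g ∈ diagram l, φ g =
      ∑ i : Fin d, ∑ a ∈ Finset.range n, ∑ b ∈ Finset.range ((l i).rowLen a), φ (a, b, i) := by
  simp only [Finset.sum_sigma']
  refine Finset.sum_bij' (fun g _ => ⟨g.2.2, g.1, g.2.1⟩) (fun x _ => (x.2.1, x.2.2, x.1))
    ?_ ?_ ?_ ?_ ?_
  · rintro ⟨a, b, c⟩ hg
    have h1 := row_lt_rank hg
    have h2 := mem_diagram_iff_lt_rowLen.1 hg
    simp only [Finset.mem_sigma, Finset.mem_univ, Finset.mem_range, true_and]
    exact ⟨h1.trans_le hn, h2⟩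
  · rintro ⟨i, a, b⟩ h
    simp only [Finset.mem_sigma, Finset.mem_univ, Finset.mem_range, true_and] at h
    exact mem_diagram_iff_lt_rowLen.2 h.2
  · intro g _
    rfl
  · intro x _
    rfl
  · intro g _
    rfl

section Bead

variable (e : ℕ) (v : Fin d → ℕ) (n : ℕ)

/-- The value of `d * entry` for an empty row. -/
def beadBase (i : Fin d) (a : ℕ) : ℤ := d * ((n : ℤ) - (a + 1) + v i + e) - e * (i : ℕ)

/-- The integers `d * entry`, for a `d`-partition of rank `n`. -/
def bead (l : Multipartition d) (i : Fin d) (a : ℕ) : ℤ :=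
  beadBase e v n i a + d * (l i).rowLen a

/-- The number of beads of value at least `T`. -/
def beadCount (l : Multipartition d) (T : ℤ) : ℤ :=
  ∑ i : Fin d, ∑ a ∈ Finset.range n, if T ≤ bead e v n l i a then 1 else 0

variable {e v n}

theorem beadBase_nonneg (i : Fin d) {a : ℕ} (ha : a ∈ Finset.range n) :
    0 ≤ beadBase e v n i a := by
  rw [Finset.mem_range] at ha
  have hi : (e : ℤ) * (i : ℕ) ≤ e * d :=
    mul_le_mul_of_nonneg_left (by exact_mod_cast i.isLt.le) (by positivity)
  have h0 : 0 ≤ (d : ℤ) * ((n : ℤ) - (a + 1) + v i) := mul_nonneg (by positivity) (by omega)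
  rw [beadBase, mul_add]
  linarith [mul_comm (e : ℤ) d]

theorem bead_nonneg (l : Multipartition d) (i : Fin d) {a : ℕ} (ha : a ∈ Finset.range n) :
    0 ≤ bead e v n l i a := add_nonneg (beadBase_nonneg i ha) (by positivity)

/-- After `b + 1` nodes are added to an empty row, its bead is the position of the last node, up to
a constant shift. -/
theorem beadBase_add (i : Fin d) (a b : ℕ) :
    beadBase e v n i a + d * (b + 1) = position e v (a, b, i) + d * (n + e) := by
  simp only [beadBase, position, content]
  ring

theorem entry_eq (hd : 0 < d) {l : Multipartition d} (hn : rank l = n) (i : Fin d) (a : ℕ) :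
    entry e v l i a = (bead e v n l i a : ℚ) / d := by
  have : (d : ℚ) ≠ 0 := by exact_mod_cast hd.ne'
  rw [entry, shift, hn, bead, beadBase]
  push_cast
  field_simp
  ring

/-- Each node moves the bead of its row by `d`, so the indicator of `T ≤ bead` telescopes along the
row. -/
theorem beadCount_eq {l : Multipartition d} (hn : rank l = n) (T : ℤ) :
    beadCount e v n l T =
      (∑ i : Fin d, ∑ a ∈ Finset.range n, if T ≤ beadBase e v n i a then 1 else 0) +
      (posCount e v l (T - d * (n + e)) - posCount e v l (T + d - d * (n + e))) := by
  have hpos : ∀ T : ℤ, (posCount e v l (T - d * (n + e)) : ℤ) =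
      ∑ g ∈ diagram l, if T ≤ position e v g + d * (n + e) then 1 else 0 := by
    intro T
    rw [posCount, Finset.sum_boole]
    simp only [sub_le_iff_le_add]
  rw [hpos, hpos, ← Finset.sum_sub_distrib, sum_diagram hn.le, beadCount,
    ← Finset.sum_add_distrib]
  refine Finset.sum_congr rfl fun i _ => ?_
  rw [← Finset.sum_add_distrib]
  refine Finset.sum_congr rfl fun a _ => ?_
  have : ∀ b : ℕ, ((if T ≤ position e v (a, b, i) + d * (n + e) then 1 else 0) -
      (if T + d ≤ position e v (a, b, i) + d * (n + e) then 1 else 0) : ℤ) =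
      (if T ≤ beadBase e v n i a + d * ((b + 1 : ℕ) : ℤ) then 1 else 0) -
      (if T ≤ beadBase e v n i a + d * (b : ℤ) then 1 else 0) := by
    intro b
    have hiff : T + d ≤ beadBase e v n i a + d * ((b : ℤ) + 1) ↔
        T ≤ beadBase e v n i a + d * (b : ℤ) := by
      rw [mul_add, mul_one, ← add_assoc, add_le_add_iff_right]
    rw [← beadBase_add]
    simp only [hiff]
    push_cast
    rfl
  rw [Finset.sum_congr rfl fun b _ => this b, Finset.sum_range_sub
    (fun b : ℕ => (if T ≤ beadBase e v n i a + d * (b : ℤ) then 1 else 0 : ℤ)), bead]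
  simp

theorem beadCount_antitone (l : Multipartition d) : Antitone (beadCount e v n l) := by
  intro T T' h
  refine Finset.sum_le_sum fun i _ => Finset.sum_le_sum fun a _ => ?_
  split_ifs <;> omega

theorem sum_bead {l : Multipartition d} (hn : rank l = n) :
    ∑ i : Fin d, ∑ a ∈ Finset.range n, bead e v n l i a =
      (∑ i : Fin d, ∑ a ∈ Finset.range n, beadBase e v n i a) + d * n := by
  have h := sum_diagram hn.le (fun _ => (1 : ℤ))
  simp only [Finset.sum_const, card_diagram, hn, Finset.card_range, nsmul_eq_mul, mul_one] at h
  rw [h, Finset.mul_sum, ← Finset.sum_add_distrib]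
  refine Finset.sum_congr rfl fun i _ => ?_
  rw [Finset.mul_sum, ← Finset.sum_add_distrib]
  rfl

/-- For nonnegative beads, `min x y` counts the levels `T ≥ 1` below both, so summing over ordered
pairs gives squares. -/
theorem sum_min_bead {l : Multipartition d} {N : ℕ}
    (hN : ∀ i, ∀ a ∈ Finset.range n, bead e v n l i a ≤ N) :
    ∑ i : Fin d, ∑ a ∈ Finset.range n, ∑ j : Fin d, ∑ b ∈ Finset.range n,
      min (bead e v n l i a) (bead e v n l j b) =
      ∑ T ∈ Finset.Icc (1 : ℤ) N, beadCount e v n l T ^ 2 := by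
  have hpair : ∀ φ : Fin d → ℕ → ℤ, ∑ i : Fin d, ∑ a ∈ Finset.range n, φ i a =
      ∑ p ∈ Finset.univ ×ˢ Finset.range n, φ p.1 p.2 := fun φ => (Finset.sum_product' _ _ φ).symm
  simp only [sq, beadCount, hpair, Finset.sum_mul_sum]
  symm
  rw [Finset.sum_comm]
  refine Finset.sum_congr rfl fun p hp => ?_
  rw [Finset.sum_comm]
  refine Finset.sum_congr rfl fun p' hp' => ?_
  rw [Finset.mem_product] at hp hp'
  rw [sum_Icc_ite_mul_ite (bead_nonneg l _ hp.2) (bead_nonneg l _ hp'.2) (hN _ _ hp.2)]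

/-- With `D ≤ 0` the difference of position counts, the bead counts differ by `D T - D (T + d)`.
Expanding the squares gives a sum of squares plus a cross term that is nonnegative by summation by
parts. -/
theorem sum_min_bead_le (hd : 0 < d) {l m : Multipartition d} (hl : rank l = n)
    (hm : rank m = n) (h : ∀ T, posCount e v m T ≤ posCount e v l T) :
    let S := fun x : Multipartition d =>
      ∑ i : Fin d, ∑ a ∈ Finset.range n, ∑ j : Fin d, ∑ b ∈ Finset.range n,
        min (bead e v n x i a) (bead e v n x j b)
    S l ≤ S m ∧ (S m ≤ S l → ∀ T, posCount e v m T = posCount e v l T) := by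
  intro S
  obtain ⟨N, hN⟩ : ∃ N : ℕ, ∀ x ∈ ({l, m} : Set (Multipartition d)), ∀ i,
      ∀ a ∈ Finset.range n, bead e v n x i a ≤ N := by
    obtain ⟨N₁, h₁⟩ := ((Finset.univ ×ˢ Finset.range n).image
      fun p : Fin d × ℕ => bead e v n l p.1 p.2).bddAbove
    obtain ⟨N₂, h₂⟩ := ((Finset.univ ×ˢ Finset.range n).image
      fun p : Fin d × ℕ => bead e v n m p.1 p.2).bddAbove
    refine ⟨(max N₁ N₂).toNat, ?_⟩
    rintro x (rfl | rfl) i a ha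
    · have := h₁ (Finset.mem_image_of_mem _ (a := (i, a)) (by simpa using ha))
      dsimp only at this
      omega
    · have := h₂ (Finset.mem_image_of_mem _ (a := (i, a)) (by simpa using ha))
      dsimp only at this
      omega
  set D : ℤ → ℤ := fun T =>
    posCount e v m (T - d * (n + e)) - posCount e v l (T - d * (n + e)) with hD
  have hD0 : ∀ T, D T ≤ 0 := fun T => by
    have := h (T - d * (n + e))
    simp only [hD]
    omega
  have hlow : ∀ T ≤ (d : ℤ), D T = 0 := by
    intro T hT
    have : ∀ x : Multipartition d, rank x = n → posCount e v x (T - d * (n + e)) = n := by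
      intro x hx
      rw [posCount, Finset.filter_true_of_mem, card_diagram, hx]
      rintro ⟨a, b, c⟩ hg
      have h1 := beadBase_add (e := e) (v := v) (n := n) c a b
      have h2 := beadBase_nonneg (e := e) (v := v) (n := n) c (a := a)
        (Finset.mem_range.2 (hx ▸ row_lt_rank hg))
      have h3 : 0 ≤ (d : ℤ) * b := by positivity
      rw [mul_add, mul_one] at h1
      omega
    simp [hD, this l hl, this m hm]
  have hhigh : ∀ T, (N : ℤ) < T → D T = 0 := by
    intro T hT
    have : ∀ x ∈ ({l, m} : Set (Multipartition d)), rank x = n →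
        posCount e v x (T - d * (n + e)) = 0 := by
      intro x hx hxn
      rw [posCount, Finset.card_eq_zero, Finset.filter_eq_empty_iff]
      rintro ⟨a, b, c⟩ hg
      have h1 := beadBase_add (e := e) (v := v) (n := n) c a b
      have h2 := hN x hx c a (Finset.mem_range.2 (hxn ▸ row_lt_rank hg))
      have h3 : (d : ℤ) * (b + 1) ≤ d * (x c).rowLen a :=
        mul_le_mul_of_nonneg_left (by exact_mod_cast mem_diagram_iff_lt_rowLen.1 hg)
          (by positivity)
      rw [bead] at h2
      omega
    simp [hD, this l (by simp) hl, this m (by simp) hm]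
  have hΔ : ∀ T, beadCount e v n m T = beadCount e v n l T + (D T - D (T + d)) := by
    intro T
    rw [beadCount_eq hl, beadCount_eq hm]
    simp only [hD]
    ring
  have hS : S m - S l = ∑ T ∈ Finset.Icc (1 : ℤ) N, (D T - D (T + d)) ^ 2 +
      2 * ∑ T ∈ Finset.Icc (1 : ℤ) N, beadCount e v n l T * (D T - D (T + d)) := by
    simp only [S]
    rw [sum_min_bead (hN l (by simp)), sum_min_bead (hN m (by simp)), ← Finset.sum_sub_distrib,
      Finset.mul_sum, ← Finset.sum_add_distrib]
    refine Finset.sum_congr rfl fun T _ => ?_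
    rw [hΔ]
    ring
  have hparts := sum_mul_sub_shift_nonneg hD0 hlow hhigh (beadCount_antitone (e := e) (v := v)
    (n := n) l)
  have hsq : ∀ T ∈ Finset.Icc (1 : ℤ) N, 0 ≤ (D T - D (T + d)) ^ 2 := fun T _ => sq_nonneg _
  have hsq' := Finset.sum_nonneg hsq
  refine ⟨by omega, fun hle => ?_⟩
  have hzero := (Finset.sum_eq_zero_iff_of_nonneg hsq).1 (by omega)
  -- Vanishing squares make `D` invariant under steps of `d` for `1 ≤ T ≤ N`, so its vanishing above
  -- `N` propagates downwards.
  have hDz : ∀ j : ℕ, D (N + 1 - j) = 0 := by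
    intro j
    induction j using Nat.strong_induction_on with
    | _ j ih =>
    by_cases h1 : (N : ℤ) < N + 1 - j
    · exact hhigh _ h1
    · by_cases h2 : (N + 1 - j : ℤ) ≤ d
      · exact hlow _ h2
      · have h3 := pow_eq_zero_iff (two_ne_zero) |>.1
          (hzero (N + 1 - j) (Finset.mem_Icc.2 (by omega)))
        rw [sub_eq_zero.1 h3]
        rcases lt_or_ge j d with hj | hj
        · exact hhigh _ (by omega)
        · have h4 := ih (j - d) (by omega)
          rwa [Nat.cast_sub hj, ← sub_add] at h4
  intro T
  have hT : D (T + d * (n + e)) = 0 := by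
    by_cases h1 : (N : ℤ) < T + d * (n + e)
    · exact hhigh _ h1
    · have := hDz (N + 1 - (T + d * (n + e))).toNat
      rwa [Int.toNat_of_nonneg (by omega), sub_sub_cancel] at this
  simp only [hD, add_sub_cancel_right] at hT
  omega

/-- The double sum in `aOne`, over unordered pairs, from the sum over ordered pairs. -/
theorem two_mul_sum_min_entry (l : Multipartition d) (n : ℕ) :
    2 * (∑ i : Fin d, ∑ j : Fin d, ∑ a ∈ Finset.range n, ∑ b ∈ Finset.range n,
      if i < j ∨ (i = j ∧ entry e v l j b < entry e v l i a) then
        min (entry e v l i a) (entry e v l j b) else 0) +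
      ∑ i : Fin d, ∑ a ∈ Finset.range n, entry e v l i a =
    ∑ i : Fin d, ∑ a ∈ Finset.range n, ∑ j : Fin d, ∑ b ∈ Finset.range n,
      min (entry e v l i a) (entry e v l j b) := by
  -- Within a component, comparing entries thus amounts to comparing row indices, and the ordered
  -- pairs split into two symmetric halves and the diagonal.
  have hanti : ∀ i : Fin d, StrictAnti (entry e v l i) := by
    intro i
    refine strictAnti_nat_of_succ_lt fun a => ?_
    have : (((l i).rowLen (a + 1) : ℕ) : ℚ) ≤ (l i).rowLen a := by
      exact_mod_cast (l i).rowLen_anti _ _ (Nat.le_succ a)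
    simp only [entry]
    push_cast
    linarith
  have h1 : ∑ i : Fin d, ∑ j : Fin d, ∑ a ∈ Finset.range n, ∑ b ∈ Finset.range n,
      (if i < j ∨ (i = j ∧ entry e v l j b < entry e v l i a) then
        min (entry e v l i a) (entry e v l j b) else 0) =
      ∑ p ∈ Finset.univ ×ˢ Finset.range n, ∑ p' ∈ Finset.univ ×ˢ Finset.range n,
        if p.1 < p'.1 ∨ (p.1 = p'.1 ∧ p.2 < p'.2) then
          min (entry e v l p.1 p.2) (entry e v l p'.1 p'.2) else 0 := by
    simp only [Finset.sum_product]
    refine Finset.sum_congr rfl fun i _ => ?_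
    rw [Finset.sum_comm]
    refine Finset.sum_congr rfl fun a _ => Finset.sum_congr rfl fun j _ =>
      Finset.sum_congr rfl fun b _ => ?_
    congr 1
    rw [eq_iff_iff]
    refine or_congr_right (and_congr_right ?_)
    rintro rfl
    exact (hanti i).lt_iff_gt
  have h2 : ∑ i : Fin d, ∑ a ∈ Finset.range n, entry e v l i a =
      ∑ p ∈ Finset.univ ×ˢ Finset.range n, ∑ p' ∈ Finset.univ ×ˢ Finset.range n,
        if p = p' then min (entry e v l p.1 p.2) (entry e v l p'.1 p'.2) else 0 := by
    rw [← Finset.sum_product']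
    refine Finset.sum_congr rfl fun p hp => ?_
    rw [Finset.sum_ite_eq, if_pos hp, min_self]
  rw [h1, h2, two_mul]
  conv_lhs =>
    enter [1, 2]
    rw [Finset.sum_comm]
  simp only [← Finset.sum_add_distrib]
  rw [Finset.sum_product]
  refine Finset.sum_congr rfl fun i _ => Finset.sum_congr rfl fun a _ => ?_
  rw [Finset.sum_product]
  refine Finset.sum_congr rfl fun j _ => Finset.sum_congr rfl fun b _ => ?_
  dsimp only
  rw [min_comm (entry e v l j b)]
  simp only [Prod.mk.injEq]
  rcases lt_trichotomy i j with h | rfl | h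
  · simp [h, h.not_gt, h.ne, h.ne']
  · rcases lt_trichotomy a b with h | rfl | h
    · simp [h, h.not_gt, h.ne]
    · simp
    · simp [h, h.not_gt, h.ne']
  · simp [h, h.not_gt, h.ne, h.ne']

/-- The second sum in `aOne` is, up to a constant, a sum over nodes. -/
theorem sum_min_shift_eq (hd : 0 < d) {l : Multipartition d} (hn : rank l = n) :
    ∑ i : Fin d, ∑ j : Fin d, ∑ a ∈ Finset.range n,
      ∑ k ∈ Finset.Icc 1 ⌊entry e v l i a⌋₊, min (k : ℚ) (shift e v j) =
    (∑ i : Fin d, ∑ a ∈ Finset.range n, ∑ k ∈ Finset.Icc 1 ⌊(beadBase e v n i a : ℚ) / d⌋₊,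
      ∑ j : Fin d, min (k : ℚ) (shift e v j)) +
    ∑ g ∈ diagram l, ∑ j : Fin d,
      min ((⌊((position e v g + d * (n + e) : ℤ) : ℚ) / d⌋₊ : ℕ) : ℚ) (shift e v j) := by
  have hd' : (d : ℚ) ≠ 0 := by exact_mod_cast hd.ne'
  rw [sum_diagram hn.le, ← Finset.sum_add_distrib]
  refine Finset.sum_congr rfl fun i _ => ?_
  rw [Finset.sum_comm, ← Finset.sum_add_distrib]
  refine Finset.sum_congr rfl fun a ha => ?_
  rw [Finset.sum_comm]
  have hb : (0 : ℚ) ≤ (beadBase e v n i a : ℚ) / d :=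
    div_nonneg (by exact_mod_cast beadBase_nonneg i ha) (by positivity)
  -- The number of values of `k` grows by one per node, so each node accounts for exactly one new
  -- summand.
  have hfloor : ∀ r : ℕ, ⌊((beadBase e v n i a + d * r : ℤ) : ℚ) / d⌋₊ =
      ⌊(beadBase e v n i a : ℚ) / d⌋₊ + r := by
    intro r
    rw [← Nat.floor_add_natCast hb]
    congr 1
    push_cast
    field_simp
  have hnode : ∀ b : ℕ, ⌊((position e v (a, b, i) + d * (n + e) : ℤ) : ℚ) / d⌋₊ =
      ⌊(beadBase e v n i a : ℚ) / d⌋₊ + (b + 1) := by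
    intro b
    rw [← beadBase_add, ← hfloor]
    push_cast
    rfl
  simp only [hnode]
  rw [entry_eq hd hn, bead, hfloor]
  generalize ⌊(beadBase e v n i a : ℚ) / d⌋₊ = B
  induction (l i).rowLen a with
  | zero => simp
  | succ r ih =>
    rw [← add_assoc, Finset.sum_Icc_succ_top (by omega), ih, Finset.sum_range_succ, add_assoc]
    rfl

theorem aOne_le (hd : 0 < d) {l m : Multipartition d} (hrank : rank m = rank l)
    (h : ∀ T, posCount e v m T ≤ posCount e v l T) :
    aOne e v l ≤ aOne e v m ∧
      (aOne e v m ≤ aOne e v l → ∀ T, posCount e v m T = posCount e v l T) := by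
  obtain ⟨hS, hS'⟩ := sum_min_bead_le (e := e) hd rfl hrank h
  have hd' : (0 : ℚ) < d := by exact_mod_cast hd
  have hmin : ∀ x : Multipartition d, rank x = rank l →
      -- The factor `2` passes to ordered pairs, and `d` clears the denominators of the entries.
      2 * d * (∑ i : Fin d, ∑ j : Fin d, ∑ a ∈ Finset.range (rank l), ∑ b ∈ Finset.range (rank l),
      if i < j ∨ (i = j ∧ entry e v x j b < entry e v x i a) then
        min (entry e v x i a) (entry e v x j b) else 0) +
      ((∑ i : Fin d, ∑ a ∈ Finset.range (rank l), beadBase e v (rank l) i a) + d * rank l : ℤ) =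
      ((∑ i : Fin d, ∑ a ∈ Finset.range (rank l), ∑ j : Fin d, ∑ b ∈ Finset.range (rank l),
        min (bead e v (rank l) x i a) (bead e v (rank l) x j b) : ℤ) : ℚ) := by
    intro x hx
    have h2 := congrArg (fun y : ℚ => d * y) (two_mul_sum_min_entry (e := e) (v := v) x (rank l))
    simp only [mul_add] at h2
    rw [← sum_bead hx]
    push_cast
    rw [mul_comm 2 (d : ℚ), mul_assoc]
    convert h2 using 1
    · congr 1
      simp only [Finset.mul_sum]
      refine Finset.sum_congr rfl fun i _ => Finset.sum_congr rfl fun a _ => ?_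
      rw [entry_eq hd hx, mul_div_cancel₀ _ hd'.ne']
    · simp only [Finset.mul_sum]
      refine Finset.sum_congr rfl fun i _ => Finset.sum_congr rfl fun a _ =>
        Finset.sum_congr rfl fun j _ => Finset.sum_congr rfl fun b _ => ?_
      rw [entry_eq hd hx, entry_eq hd hx, mul_min_of_nonneg _ _ hd'.le,
        mul_div_cancel₀ _ hd'.ne', mul_div_cancel₀ _ hd'.ne']
  have hsecond := sum_le_sum_of_card_le (s := diagram m) (t := diagram l) (position e v)
    (by rw [card_diagram, card_diagram, hrank]) h
    (φ := fun T => ∑ j : Fin d,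
      min ((⌊((T + d * (rank l + e) : ℤ) : ℚ) / d⌋₊ : ℕ) : ℚ) (shift e v j)) (by
      intro T T' hT
      refine Finset.sum_le_sum fun j _ => min_le_min ?_ le_rfl
      refine Nat.cast_le.2 (Nat.floor_le_floor ?_)
      refine div_le_div_of_nonneg_right (Int.cast_le.2 ?_) hd'.le
      omega)
  have hl := hmin l rfl
  have hm := hmin m hrank
  rw [aOne, aOne, hrank, sum_min_shift_eq hd rfl, sum_min_shift_eq hd hrank]
  set Fl := ∑ i : Fin d, ∑ j : Fin d, ∑ a ∈ Finset.range (rank l), ∑ b ∈ Finset.range (rank l),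
      if i < j ∨ (i = j ∧ entry e v l j b < entry e v l i a) then
        min (entry e v l i a) (entry e v l j b) else 0
  set Fm := ∑ i : Fin d, ∑ j : Fin d, ∑ a ∈ Finset.range (rank l), ∑ b ∈ Finset.range (rank l),
      if i < j ∨ (i = j ∧ entry e v m j b < entry e v m i a) then
        min (entry e v m i a) (entry e v m j b) else 0
  dsimp only at hS hS' hsecond
  have hFle : Fl ≤ Fm := by
    have : (2 * d : ℚ) * Fl ≤ 2 * d * Fm := by
      have := (Int.cast_le (R := ℚ)).2 hS
      linarith
    exact le_of_mul_le_mul_left this (by positivity)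
  refine ⟨by linarith, fun hle => hS' ?_⟩
  have hFle' : Fm ≤ Fl := by linarith
  have := mul_le_mul_of_nonneg_left hFle' (by positivity : (0 : ℚ) ≤ 2 * d)
  refine (Int.cast_le (R := ℚ)).1 ?_
  linarith

end Bead

/-! Decomposition of an `a`-sequence into blocks -/

theorem replicate_append_inj {α : Type*} {k : α} {X Y : List α} (hX : X.head? ≠ some k)
    (hY : Y.head? ≠ some k) {a b : ℕ} (h : List.replicate a k ++ X = List.replicate b k ++ Y) :
    a = b ∧ X = Y := by
  induction a generalizing b with
  | zero =>
    cases b with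
    | zero => simpa using h
    | succ b =>
      rw [List.replicate_zero, List.nil_append] at h
      exact absurd (by rw [h]; rfl) hX
  | succ a ih =>
    cases b with
    | zero =>
      rw [List.replicate_zero, List.nil_append] at h
      exact absurd (by rw [← h]; rfl) hY
    | succ b =>
      rw [List.replicate_succ, List.replicate_succ, List.cons_append, List.cons_append,
        List.cons.injEq] at h
      have := ih h.2
      exact ⟨by omega, this.2⟩

theorem append_replicate_inj {α : Type*} {j k : α} {X Y : List α} (hX : X.getLast? ≠ some j)
    (hY : Y.getLast? ≠ some k) {a b : ℕ} (ha : 0 < a) (hb : 0 < b)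
    (h : X ++ List.replicate a j = Y ++ List.replicate b k) : j = k ∧ a = b ∧ X = Y := by
  obtain ⟨a, rfl⟩ : ∃ a', a = a' + 1 := ⟨a - 1, by omega⟩
  obtain ⟨b, rfl⟩ : ∃ b', b = b' + 1 := ⟨b - 1, by omega⟩
  have hr := congrArg List.reverse h
  rw [List.reverse_append, List.reverse_append, List.reverse_replicate,
    List.reverse_replicate] at hr
  have hjk : j = k := by
    have := congrArg List.head? hr
    simpa [List.replicate_succ] using this
  subst hjk
  obtain ⟨h1, h2⟩ := replicate_append_inj (by rwa [List.head?_reverse])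
    (by rwa [List.head?_reverse]) hr
  exact ⟨rfl, h1, List.reverse_injective h2⟩

/-- Run-length encoding is unique: as `S` does not end in `k`, the final run of `k` is exactly the
last block of `L`. -/
theorem exists_eq_append_of_flatMap_eq {α : Type*} {L : List (α × ℕ)} (hpos : ∀ p ∈ L, 0 < p.2)
    (hchain : L.IsChain fun p p' => p.1 ≠ p'.1) {S : List α} {k : α} {s : ℕ} (hs : 0 < s)
    (hS : S.getLast? ≠ some k)
    (h : (L.flatMap fun p => List.replicate p.2 p.1) = S ++ List.replicate s k) :
    ∃ L', L = L' ++ [(k, s)] ∧ (L'.flatMap fun p => List.replicate p.2 p.1) = S := by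
  rcases L.eq_nil_or_concat with rfl | ⟨L', ⟨j, a⟩, rfl⟩
  · have := congrArg List.length h
    simp at this
    omega
  · rw [List.concat_eq_append] at *
    have ha : 0 < a := hpos (j, a) (by simp)
    rw [List.flatMap_append, List.flatMap_singleton] at h
    have hL' : (L'.flatMap fun p => List.replicate p.2 p.1).getLast? ≠ some j := by
      rcases L'.eq_nil_or_concat with rfl | ⟨L'', ⟨i, b⟩, rfl⟩
      · simp
      · rw [List.concat_eq_append] at *
        have hb : 0 < b := hpos (i, b) (by simp)
        have hij : i ≠ j := by
          rw [List.append_assoc] at hchain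
          exact (List.isChain_append.1 hchain).2.1.rel
        rw [List.flatMap_append, List.flatMap_singleton, List.getLast?_append,
          List.getLast?_replicate, if_neg hb.ne']
        simpa using hij
    obtain ⟨rfl, rfl, hLS⟩ := append_replicate_inj hL' hS ha hs h
    exact ⟨L', rfl, hLS⟩

/-! ### The vector attached to an `a`-sequence: integrality, leading coefficient, support -/

section

variable {e : ℕ} {v : Fin d → ℕ}

theorem applyDiv_append (L : List (ZMod e × ℕ)) (k : ZMod e) (s : ℕ) :
    applyDiv e v (L ++ [(k, s)]) = fDiv e v k s (applyDiv e v L) := by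
  rw [applyDiv, List.foldl_append]
  rfl

theorem laurentToRatFunc_T (n : ℤ) : laurentToRatFunc (LaurentPolynomial.T n) = q ^ n := by
  rw [laurentToRatFunc, LaurentPolynomial.eval₂_T]
  simp

theorem q_zpow_mem_range (n : ℤ) : q ^ n ∈ laurentToRatFunc.range :=
  ⟨LaurentPolynomial.T n, laurentToRatFunc_T n⟩

/-- Applying the divided power of a step of an `a`-sequence keeps the coefficients integral, keeps
the leading coefficient, and keeps the bounds on the number of nodes to the right of a column. -/
theorem fDiv_strip (hmono : Monotone v) (hlt : ∀ j, v j < e) (h1 : (1 : ZMod e) ≠ 0)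
    {l l' : Multipartition d} (hl : IsFLOTW e v l) {k : ZMod e}
    (hl' : diagram l' = diagram l \ strip e v l k) {U : Fock d}
    (hint : ∀ m, U m ∈ laurentToRatFunc.range) (hone : U l' = 1)
    (hU : ∀ m, U m ≠ 0 → rank m = rank l' ∧ ∀ k t, colCount e v m k t ≤ colCount e v l' k t) :
    (∀ m, fDiv e v k (strip e v l k).card U m ∈ laurentToRatFunc.range) ∧
    fDiv e v k (strip e v l k).card U l = 1 ∧
    ∀ m, fDiv e v k (strip e v l k).card U m ≠ 0 →
      rank m = rank l ∧ ∀ k t, colCount e v m k t ≤ colCount e v l k t := by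
  classical
  refine ⟨fun m => ?_, ?_, fun m hm => ?_⟩
  · rw [fDiv_apply h1]
    refine sum_mem fun x _ => mul_mem (hint x) (sum_mem fun A _ => ?_)
    split_ifs
    · exact q_zpow_mem_range _
    · exact zero_mem _
  · have hmem : l' ∈ U.support := by
      rw [Finsupp.mem_support_iff, hone]
      exact one_ne_zero
    -- Only the strip added to `l'` contributes to the coefficient of `l`.
    have hA : ∀ x ∈ U.support, ∀ A ∈ (kAddable e v k x).powersetCard (strip e v l k).card,
        addNodes x A = l → A = strip e v l k ∧ x = l' := by
      intro x hx A hA heq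
      obtain ⟨hA, hcard⟩ := Finset.mem_powersetCard.1 hA
      have hAs := addNodes_eq_imp_eq_strip h1 hl' hA hcard
        (hU x (Finsupp.mem_support_iff.1 hx)).2 heq
      refine ⟨hAs, diagram_injective ?_⟩
      rw [hl', ← heq, diagram_addNodes hA, heq, ← hAs,
        Finset.union_sdiff_cancel_right (disjoint_of_subset_kAddable hA)]
    rw [fDiv_apply h1, Finset.sum_eq_single_of_mem l' hmem, hone, one_mul,
      Finset.sum_eq_single_of_mem (strip e v l k), if_pos (addNodes_strip hl'),
      hl.stripExponent_eq_zero hmono hlt h1 hl', zpow_zero]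
    · exact Finset.mem_powersetCard.2 ⟨strip_subset_kAddable hl', rfl⟩
    · exact fun A hA' hne => if_neg fun heq => hne (hA l' hmem A hA' heq).1
    · intro x hx hne
      rw [Finset.sum_eq_zero fun A hA' => if_neg fun heq => hne (hA x hx A hA' heq).2, mul_zero]
  · rw [fDiv_apply h1] at hm
    obtain ⟨x, hx, hne⟩ := Finset.exists_ne_zero_of_sum_ne_zero hm
    obtain ⟨A, hA, hne⟩ := Finset.exists_ne_zero_of_sum_ne_zero (right_ne_zero_of_mul hne)
    obtain ⟨hA, hcard⟩ := Finset.mem_powersetCard.1 hA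
    obtain ⟨hrank, hE⟩ := hU x (Finsupp.mem_support_iff.1 hx)
    have heq : addNodes x A = m := by
      by_contra h
      exact hne (if_neg h)
    rw [← heq]
    refine ⟨?_, colCount_addNodes_le h1 hl' hA hcard hE⟩
    rw [rank_addNodes hA, hcard, hrank, ← rank_eq_add_strip hl']

theorem applyDiv_of_isASequence (hmono : Monotone v) (hlt : ∀ j, v j < e)
    {l : Multipartition d} {S : List (ZMod e)} (hS : IsASequence e v l S)
    (hl : IsFLOTW e v l) (L : List (ZMod e × ℕ)) (hpos : ∀ p ∈ L, 0 < p.2)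
    (hchain : L.IsChain fun p p' => p.1 ≠ p'.1)
    (hL : (L.flatMap fun p => List.replicate p.2 p.1) = S) :
    (∀ m, applyDiv e v L m ∈ laurentToRatFunc.range) ∧ applyDiv e v L l = 1 ∧
    ∀ m, applyDiv e v L m ≠ 0 →
      rank m = rank l ∧ ∀ k t, colCount e v m k t ≤ colCount e v l k t := by
  classical
  induction hS generalizing L with
  | empty =>
    have : L = [] := by
      rw [List.flatMap_eq_nil_iff] at hL
      refine List.eq_nil_iff_forall_not_mem.2 fun p hp => ?_
      have h0 := hL p hp
      rw [List.replicate_eq_nil_iff] at h0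
      exact (hpos p hp).ne' h0
    subst this
    simp only [applyDiv, List.foldl_nil, Finsupp.single_apply]
    refine ⟨fun m => ?_, if_true _ _, fun m hm => ?_⟩
    · split_ifs
      · exact one_mem _
      · exact zero_mem _
    · have : emptyMP d = m := by
        by_contra h
        exact hm (if_neg h)
      rw [← this]
      exact ⟨rfl, fun _ _ => le_rfl⟩
  | step l l' k S hk hk' hl' hL' ih =>
    have h1 := one_ne_zero_of_step hk hk'
    have hcard : 0 < (strip e v l k).card := by
      obtain ⟨x, hx, hm, hr⟩ := hk
      exact Finset.card_pos.2 ⟨x, mem_strip_of_step hx.1 hm hr hk'⟩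
    -- Consecutive steps have different residues, so the blocks of `L` coincide with the steps of
    -- the `a`-sequence.
    have hlast : S.getLast? ≠ some k := by
      intro hS
      cases hL' with
      | empty => simp at hS
      | step _ l'' k₂ S₂ hk₂ hk₂' hl'' hL'' =>
        have hcard₂ : 0 < (strip e v l' k₂).card := by
          obtain ⟨x, hx, hm, hr⟩ := hk₂
          exact Finset.card_pos.2 ⟨x, mem_strip_of_step hx.1 hm hr hk₂'⟩
        rw [List.getLast?_append, List.getLast?_replicate, if_neg hcard₂.ne'] at hS
        have : k₂ = k := by simpa using hS
        subst this
        exact residue_ne_of_steps hk hk' hl' hk₂ hk₂'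
    obtain ⟨L', rfl, hLS⟩ := exists_eq_append_of_flatMap_eq hpos hchain hcard hlast hL
    obtain ⟨h2, h3, h4⟩ := ih (hl.sdiff_strip hlt hmono h1 hl') L'
      (fun p hp => hpos p (List.mem_append_left _ hp)) (List.isChain_append.1 hchain).1 hLS
    rw [applyDiv_append]
    exact fDiv_strip hmono hlt h1 hl hl' h2 h3 h4

end

end JMMO

/-! ### Triangularity with respect to the `a`-value -/

theorem mainTheorem3 {d : ℕ} (hd : 0 < d) (e : ℕ) (v : Fin d → ℕ) (hmono : Monotone v)
    (hlt : ∀ j, v j < e) (f : ℕ → ℚ) (n : ℕ) (l : JMMO.Multipartition d)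
    (hn : JMMO.rank l = n) (hl : JMMO.IsFLOTW e v l) :
    (∃ S : List (ZMod e), JMMO.IsASequence e v l S) ∧
    ∀ L : List (ZMod e × ℕ), (∀ p ∈ L, 0 < p.2) → L.IsChain (fun p p' => p.1 ≠ p'.1) →
      JMMO.IsASequence e v l (L.flatMap fun p => List.replicate p.2 p.1) →
      ∃ c : JMMO.Multipartition d →₀ LaurentPolynomial ℤ,
        (∀ m ∈ c.support,
          JMMO.rank m = n ∧ JMMO.aValue e v f l < JMMO.aValue e v f m) ∧
        JMMO.applyDiv e v L =
          Finsupp.single l 1 +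
            c.sum fun m p => Finsupp.single m (JMMO.laurentToRatFunc p) := by
  classical
  refine ⟨JMMO.exists_isASequence hd hmono hlt l hl, fun L hpos hchain hL => ?_⟩
  have : NeZero e := ⟨((Nat.zero_le _).trans_lt (hlt ⟨0, hd⟩)).ne'⟩
  subst hn
  obtain ⟨hint, hone, hU⟩ := JMMO.applyDiv_of_isASequence hmono hlt hL hl L hpos hchain rfl
  choose p hp using hint
  set U := JMMO.applyDiv e v L
  -- The guard `U m = 0` keeps the support of `c` within that of `U`, whatever preimages `p` were
  -- chosen.
  let c : JMMO.Multipartition d →₀ LaurentPolynomial ℤ :=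
    Finsupp.onFinset U.support (fun m => if m = l ∨ U m = 0 then 0 else p m) fun m hm => by
      rw [Finsupp.mem_support_iff]
      exact fun h => hm (if_pos (Or.inr h))
  have hc : ∀ m, c m = if m = l ∨ U m = 0 then 0 else p m := fun m => rfl
  refine ⟨c, fun m hm => ?_, ?_⟩
  · rw [Finsupp.mem_support_iff, hc] at hm
    have hm' : ¬ (m = l ∨ U m = 0) := fun h => hm (if_pos h)
    rw [not_or] at hm'
    obtain ⟨hrank, hE⟩ := hU m hm'.2
    refine ⟨hrank, ?_⟩
    obtain ⟨-, h⟩ := JMMO.aOne_le hd hrank (hl.posCount_le hmono hlt hE)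
    rw [JMMO.aValue, JMMO.aValue, hrank, add_lt_add_iff_right]
    by_contra! hle
    exact hm'.1 (hl.eq_of_posCount_eq hmono hlt hE hrank (h hle))
  · have hsum : (c.sum fun m p => Finsupp.single m (JMMO.laurentToRatFunc p)) =
        c.mapRange JMMO.laurentToRatFunc (map_zero _) := by
      rw [← Finsupp.sum_single (c.mapRange JMMO.laurentToRatFunc (map_zero _)),
        Finsupp.sum_mapRange_index fun m => Finsupp.single_zero m]
    rw [hsum]
    ext m
    rw [Finsupp.add_apply, Finsupp.mapRange_apply, hc, Finsupp.single_apply]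
    by_cases h : m = l
    · rw [h, if_pos rfl, if_pos (Or.inl rfl), map_zero, add_zero, hone]
    · rw [if_neg (Ne.symm h), zero_add]
      by_cases h0 : U m = 0
      · rw [if_pos (Or.inr h0), map_zero, h0]
      · rw [if_neg (by tauto), hp]
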